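/- Let $G$ be a connected (simple, possibly infinite, not necessarily countable or locally finite) graph, regarded as a 1-complex, so that every edge is a copy of the real interval $[0,1]$. For $\ell : E(G)\to\mathbb R_{>0}$, identify each edge $e$ affinely with $[0,\ell(e)]$. For points $x,y$ of $G$ let $d_\ell(x,y)$ be the infimum of the lengths of the $x$--$y$ arcs in $G$, where the length of an arc is the sum of the lengths of the edges and maximal partial edges it contains. Let $|G|_\ell$ be the completion of the metric space obtained from $(G,d_\ell)$ by identifying points at distance $0$. Two rays (one-way infinite paths) of $G$ are equivalent if for every finite $S\subseteq V(G)$ they have tails in the same component of $G-S$; the equivalence classes are the vertex-ends of $G$, and $\Omega(G)$ is the set of them. Let $\mathrm{MTOP}(G)$ be the set $G\cup\Omega(G)$ with the topology generated by the following sets: * the open subsets of the interiors of edges, each such interior being a copy of $(0,1)$; * for every vertex $v$ and every $0<\varepsilon<1$, the open star of radius $\varepsilon$ around $v$, i.e. $v$ together with all points at distance less than $\varepsilon$ from $v$ on edges at $v$, every edge having length $1$; * for every $\omega\in\Omega(G)$, every finite $S\subseteq V(G)$ and every $\varepsilon>0$, the set $\widehat C_\varepsilon(S,\omega)=C(S,\omega)\cup\Omega(S,\omega)\cup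 \mathring E_\varepsilon(S,\omega)$, where $C(S,\omega)$ is the component of $G-S$ that contains a ray of $\omega$ (as a 1-complex), $\Omega(S,\omega)$ is the set of vertex-ends that have a ray in $C(S,\omega)$, and $\mathring E_\varepsilon(S,\omega)$ is the set of inner points of edges between $S$ and $C(S,\omega)$ whose distance from the endvertex in $C(S,\omega)$ is less than $\varepsilon$, every edge having length $1$. **Theorem.** There is $\ell : E(G)\to\mathbb R_{>0}$ such that $|G|_\ell\approx\mathrm{MTOP}(G)$, i.e. such that some homeomorphism $|G|_\ell\to\mathrm{MTOP}(G)$ maps the image in $|G|_\ell$ of every point $x$ of $G$ to $x$, if and only if $\mathrm{MTOP}(G)$ is metrizable. -/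

import Mathlib

open scoped ENNReal

universe u

namespace GraphCompletion

variable {V : Type u} {G : SimpleGraph V}

/-! ### The graph as a 1-complex -/

/-- A point of the 1-complex of `G`, in barycentric coordinates: it is either a vertex (one
coordinate is `1`, all others are `0`), or an inner point of an edge `ab` (the two coordinates at
`a` and `b` are positive and add up to `1`, all others are `0`). Along an edge `ab`, the coordinate
at `a` identifies the closed edge with the real interval `[0, 1]`. -/
structure Point (G : SimpleGraph V) where
  coord : V → ℝ
  mem : (∃ a, coord a = 1 ∧ ∀ w, w ≠ a → coord w = 0) ∨
    (∃ a b, G.Adj a b ∧ 0 < coord a ∧ 0 < coord b ∧ coord a + coord b = 1 ∧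
      ∀ w, w ≠ a → w ≠ b → coord w = 0)

/-- A vertex as a point of the 1-complex. -/
noncomputable def Point.vertex (G : SimpleGraph V) (a : V) : Point G where
  coord := fun w => by classical exact if w = a then 1 else 0
  mem := Or.inl ⟨a, by simp, fun w hw => by simp [hw]⟩

/-- `x` lies on the closed edge with ends `a` and `b`. -/
def Point.OnEdge (x : Point G) (a b : V) : Prop :=
  G.Adj a b ∧ x.coord a + x.coord b = 1

/-- `x` is an inner point of the edge with ends `a` and `b`. -/
def Point.InnerOf (x : Point G) (a b : V) : Prop :=
  x.OnEdge a b ∧ 0 < x.coord a ∧ 0 < x.coord b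

/-! ### The distance `d_ℓ` and the completion `|G|_ℓ` -/

/-- The total length of the edges of a walk. -/
noncomputable def walkLength (ℓ : G.edgeSet → ℝ) : {a b : V} → G.Walk a b → ℝ≥0∞
  | _, _, .nil => 0
  | a, _, .cons (v := c) h p => ENNReal.ofReal (ℓ ⟨s(a, c), h⟩) + walkLength ℓ p

open Classical in
/-- The length of the segment between two points `x`, `y` of a common closed edge `e`, where `e` is
identified affinely with the interval `[0, ℓ e]`; it is `⊤` if no edge contains both points. The
segment from a point to itself is degenerate and has length `0`. -/
noncomputable def segmentLength (ℓ : G.edgeSet → ℝ) (x y : Point G) : ℝ≥0∞ :=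
  if x = y then 0
  else ⨅ (a : V) (b : V) (h : G.Adj a b) (_ : x.OnEdge a b) (_ : y.OnEdge a b),
    ENNReal.ofReal (|x.coord a - y.coord a| * ℓ ⟨s(a, b), h⟩)

/-- The distance `d_ℓ x y`: the infimum of the lengths of the arcs from `x` to `y` in the
1-complex. Such an arc either is a segment of one edge, or consists of a (possibly degenerate)
segment from `x` to a vertex `a`, a path of `G` from `a` to a vertex `b`, and a (possibly
degenerate) segment from `b` to `y`. It is finite if `G` is connected. -/
noncomputable def arcDist (ℓ : G.edgeSet → ℝ) (x y : Point G) : ℝ≥0∞ :=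
  segmentLength ℓ x y ⊓
    ⨅ (a : V) (b : V) (p : G.Path a b),
      segmentLength ℓ x (Point.vertex G a) + walkLength ℓ p.1 +
        segmentLength ℓ (Point.vertex G b) y

theorem walkLength_append (ℓ : G.edgeSet → ℝ) {a b c : V} (p : G.Walk a b) (q : G.Walk b c) :
    walkLength ℓ (p.append q) = walkLength ℓ p + walkLength ℓ q := by
  induction p with
  | nil => simp [walkLength]
  | cons h p ih => simp [walkLength, ih, add_assoc]

theorem walkLength_reverse (ℓ : G.edgeSet → ℝ) {a b : V} (p : G.Walk a b) :
    walkLength ℓ p.reverse = walkLength ℓ p := by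
  induction p with
  | nil => simp [walkLength]
  | @cons u v w h p ih =>
    simp only [SimpleGraph.Walk.reverse_cons, walkLength_append, ih, walkLength, add_zero]
    rw [add_comm]
    congr 4
    exact Sym2.eq_swap

theorem walkLength_bypass_le [DecidableEq V] (ℓ : G.edgeSet → ℝ) {a b : V} (p : G.Walk a b) :
    walkLength ℓ p.bypass ≤ walkLength ℓ p := by
  induction p with
  | nil => simp [SimpleGraph.Walk.bypass]
  | @cons u v w h p ih =>
    simp only [SimpleGraph.Walk.bypass]
    split_ifs with hs
    · have h1 := congrArg (walkLength ℓ) (p.bypass.take_spec hs)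
      rw [walkLength_append] at h1
      calc _ ≤ walkLength ℓ p.bypass := by rw [← h1]; exact le_add_self
        _ ≤ walkLength ℓ p := ih
        _ ≤ _ := by simp only [walkLength]; exact le_add_self
    · simp only [walkLength]
      gcongr

theorem segmentLength_self (ℓ : G.edgeSet → ℝ) (x : Point G) : segmentLength ℓ x x = 0 := by
  simp [segmentLength]

theorem segmentLength_comm (ℓ : G.edgeSet → ℝ) (x y : Point G) :
    segmentLength ℓ x y = segmentLength ℓ y x := by
  have key : ∀ x y : Point G, segmentLength ℓ x y ≤ segmentLength ℓ y x := by
    intro x y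
    by_cases hxy : x = y
    · subst hxy; exact le_rfl
    · simp only [segmentLength, hxy, Ne.symm hxy, if_false]
      refine le_iInf fun a => le_iInf fun b => le_iInf fun h => le_iInf fun hx => le_iInf fun hy => ?_
      rw [abs_sub_comm]
      exact iInf_le_of_le a (iInf_le_of_le b (iInf_le_of_le h (iInf_le_of_le hy
        (iInf_le_of_le hx le_rfl))))
  exact le_antisymm (key x y) (key y x)

theorem segmentLength_le (ℓ : G.edgeSet → ℝ) {x y : Point G} {a b : V} (h : G.Adj a b)
    (hx : x.OnEdge a b) (hy : y.OnEdge a b) :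
    segmentLength ℓ x y ≤ ENNReal.ofReal (|x.coord a - y.coord a| * ℓ ⟨s(a, b), h⟩) := by
  by_cases hxy : x = y
  · simp [segmentLength, hxy]
  · simp only [segmentLength, hxy, if_false]
    exact iInf_le_of_le a (iInf_le_of_le b (iInf_le_of_le h (iInf_le_of_le hx
      (iInf_le_of_le hy le_rfl))))

theorem Point.ext_coord {x y : Point G} (h : ∀ w, x.coord w = y.coord w) : x = y := by
  cases x; cases y; congr; exact funext h

theorem Point.eq_vertex {x : Point G} {a : V} (h1 : x.coord a = 1)
    (h0 : ∀ w, w ≠ a → x.coord w = 0) : x = Point.vertex G a := by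
  refine Point.ext_coord fun w => ?_
  by_cases hw : w = a
  · subst hw; simp [Point.vertex, h1]
  · simp [Point.vertex, hw, h0 w hw]

theorem Point.onEdge_inner {x : Point G} {a b c d : V} (ha : 0 < x.coord a) (hb : 0 < x.coord b)
    (hs : x.coord a + x.coord b = 1) (h0 : ∀ w, w ≠ a → w ≠ b → x.coord w = 0)
    (h : x.OnEdge c d) : (c = a ∧ d = b) ∨ (c = b ∧ d = a) := by
  obtain ⟨hadj, hcd⟩ := h
  have hne := hadj.ne
  by_cases h1 : c = a
  · by_cases h2 : d = b
    · exact Or.inl ⟨h1, h2⟩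
    · have := h0 d (fun h => hne (h1.trans h.symm)) h2
      subst h1; linarith
  · by_cases h2 : c = b
    · by_cases h3 : d = a
      · exact Or.inr ⟨h2, h3⟩
      · have := h0 d h3 (fun h => hne (h2.trans h.symm))
        subst h2; linarith
    · have h4 := h0 c h1 h2
      by_cases h5 : d = a
      · subst h5; linarith
      · by_cases h6 : d = b
        · subst h6; linarith
        · have := h0 d h5 h6; linarith

theorem arcDist_le_through (ℓ : G.edgeSet → ℝ) (x y : Point G) {a b : V} (p : G.Walk a b) :
    arcDist ℓ x y ≤ segmentLength ℓ x (Point.vertex G a) + walkLength ℓ p +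
      segmentLength ℓ (Point.vertex G b) y := by
  classical
  refine inf_le_right.trans ?_
  refine iInf_le_of_le a (iInf_le_of_le b (iInf_le_of_le ⟨p.bypass, p.bypass_isPath⟩ ?_))
  gcongr
  exact walkLength_bypass_le ℓ p

theorem arcDist_self (ℓ : G.edgeSet → ℝ) (x : Point G) : arcDist ℓ x x = 0 :=
  le_antisymm (inf_le_left.trans (segmentLength_self ℓ x).le) zero_le

theorem arcDist_comm (ℓ : G.edgeSet → ℝ) (x y : Point G) : arcDist ℓ x y = arcDist ℓ y x := by
  have key : ∀ x y : Point G, arcDist ℓ x y ≤ arcDist ℓ y x := by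
    intro x y
    refine le_inf (inf_le_left.trans (segmentLength_comm ℓ x y).le) ?_
    refine le_iInf fun a => le_iInf fun b => le_iInf fun p => ?_
    refine (arcDist_le_through ℓ x y p.1.reverse).trans (le_of_eq ?_)
    rw [walkLength_reverse, segmentLength_comm ℓ x, segmentLength_comm ℓ _ y]
    ring
  exact le_antisymm (key x y) (key y x)

theorem arcDist_le_segment_add (ℓ : G.edgeSet → ℝ) (x y z : Point G) :
    arcDist ℓ x z ≤ segmentLength ℓ x y + segmentLength ℓ y z := by
  rcases y.mem with ⟨a, h1, h0⟩ | ⟨a, b, hab, ha, hb, hs, h0⟩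
  · rw [Point.eq_vertex h1 h0]
    simpa [walkLength] using arcDist_le_through ℓ x z (SimpleGraph.Walk.nil : G.Walk a a)
  · refine inf_le_left.trans ?_
    by_cases hxy : x = y
    · subst hxy; exact le_add_self
    by_cases hyz : y = z
    · subst hyz; exact le_self_add
    conv_rhs => rw [segmentLength, if_neg hxy, segmentLength, if_neg hyz]
    simp only [ENNReal.iInf_add, ENNReal.add_iInf]
    refine le_iInf fun c' => le_iInf fun d' => le_iInf fun hcd' => le_iInf fun hy' =>
      le_iInf fun hz => le_iInf fun c => le_iInf fun d => le_iInf fun hcd => le_iInf fun hx =>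
      le_iInf fun hy => ?_
    have hedge : (c' = c ∧ d' = d) ∨ (c' = d ∧ d' = c) := by
      rcases Point.onEdge_inner ha hb hs h0 hy with ⟨rfl, rfl⟩ | ⟨rfl, rfl⟩ <;>
      rcases Point.onEdge_inner ha hb hs h0 hy' with ⟨rfl, rfl⟩ | ⟨rfl, rfl⟩ <;> simp
    have main : ∀ r : ℝ, ENNReal.ofReal (|x.coord c - z.coord c| * r) ≤
        ENNReal.ofReal (|x.coord c - y.coord c| * r) +
          ENNReal.ofReal (|y.coord c - z.coord c| * r) := by
      intro r
      rw [ENNReal.ofReal_mul (abs_nonneg _), ENNReal.ofReal_mul (abs_nonneg _),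
        ENNReal.ofReal_mul (abs_nonneg _), ← add_mul,
        ← ENNReal.ofReal_add (abs_nonneg _) (abs_nonneg _)]
      gcongr
      exact abs_sub_le _ _ _
    rcases hedge with ⟨rfl, rfl⟩ | ⟨rfl, rfl⟩
    · exact (segmentLength_le ℓ hcd hx hz).trans (main _)
    · have hz2 : z.OnEdge d' c' := ⟨hcd, by rw [add_comm]; exact hz.2⟩
      refine (segmentLength_le ℓ hcd hx hz2).trans ((main _).trans (le_of_eq ?_))
      have e1 : |y.coord c' - z.coord c'| = |y.coord d' - z.coord d'| := by
        rw [← abs_neg]; congr 1; linarith [hy'.2, hz.2]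
      have e2 : (⟨s(c', d'), hcd'⟩ : G.edgeSet) = ⟨s(d', c'), hcd⟩ :=
        Subtype.ext Sym2.eq_swap
      rw [e1, e2]

theorem exists_walk_of_vertices (ℓ : G.edgeSet → ℝ) (a b : V) :
    (⨅ p : G.Walk a b, walkLength ℓ p) ≤
      segmentLength ℓ (Point.vertex G a) (Point.vertex G b) := by
  by_cases hab : a = b
  · subst hab
    exact (iInf_le _ SimpleGraph.Walk.nil).trans (by simp [walkLength])
  have hne : Point.vertex G a ≠ Point.vertex G b := by
    intro h
    have := congrArg (fun x => Point.coord x a) h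
    simp [Point.vertex, hab] at this
  rw [segmentLength, if_neg hne]
  refine le_iInf fun c => le_iInf fun d => le_iInf fun hcd => le_iInf fun hx => le_iInf fun hy => ?_
  obtain ⟨_, hx⟩ := hx
  obtain ⟨_, hy⟩ := hy
  have hcd' := hcd.ne
  simp only [Point.vertex] at hx hy
  have hedge : (c = a ∧ d = b) ∨ (c = b ∧ d = a) := by
    by_cases h1 : c = a <;> by_cases h2 : d = a <;> by_cases h3 : c = b <;>
      by_cases h4 : d = b <;> simp_all
  rcases hedge with ⟨rfl, rfl⟩ | ⟨rfl, rfl⟩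
  · refine (iInf_le _ (SimpleGraph.Walk.cons hcd .nil)).trans ?_
    simp [walkLength, Point.vertex, hcd']
  · refine (iInf_le _ (SimpleGraph.Walk.cons hcd.symm .nil)).trans ?_
    simp [walkLength, Point.vertex, hcd', Sym2.eq_swap]

theorem iInf_walk_triangle (ℓ : G.edgeSet → ℝ) (a b c : V) :
    (⨅ p : G.Walk a c, walkLength ℓ p) ≤
      (⨅ p : G.Walk a b, walkLength ℓ p) + ⨅ p : G.Walk b c, walkLength ℓ p := by
  simp only [ENNReal.iInf_add, ENNReal.add_iInf]
  refine le_iInf fun p => le_iInf fun q => ?_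
  rw [← walkLength_append]
  exact iInf_le _ _

theorem iInf_walk_le_arcDist (ℓ : G.edgeSet → ℝ) (a b : V) :
    (⨅ p : G.Walk a b, walkLength ℓ p) ≤
      arcDist ℓ (Point.vertex G a) (Point.vertex G b) := by
  refine le_inf (exists_walk_of_vertices ℓ a b) ?_
  refine le_iInf fun c => le_iInf fun d => le_iInf fun p => ?_
  calc (⨅ p : G.Walk a b, walkLength ℓ p)
      ≤ ((⨅ p : G.Walk a c, walkLength ℓ p) + ⨅ p : G.Walk c d, walkLength ℓ p) +
          ⨅ p : G.Walk d b, walkLength ℓ p :=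
        (iInf_walk_triangle ℓ a d b).trans (by gcongr; exact iInf_walk_triangle ℓ a c d)
    _ ≤ _ := by
        gcongr
        · exact exists_walk_of_vertices ℓ a c
        · exact iInf_le _ p.1
        · exact exists_walk_of_vertices ℓ d b

theorem arcDist_le_segment_add_through (ℓ : G.edgeSet → ℝ) (x y z : Point G) {a b : V}
    (p : G.Walk a b) :
    arcDist ℓ x z ≤ segmentLength ℓ x y + (segmentLength ℓ y (Point.vertex G a) +
      walkLength ℓ p + segmentLength ℓ (Point.vertex G b) z) := by
  have h : arcDist ℓ x z ≤ arcDist ℓ x (Point.vertex G a) + walkLength ℓ p +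
      segmentLength ℓ (Point.vertex G b) z := by
    rw [arcDist, arcDist, ← min_add_add_right, ← min_add_add_right]
    refine le_min (arcDist_le_through ℓ x z p) ?_
    simp only [ENNReal.iInf_add]
    refine le_iInf fun c => le_iInf fun d => le_iInf fun q => ?_
    have h1 : (⨅ r : G.Walk c b, walkLength ℓ r) ≤ walkLength ℓ q.1 +
        segmentLength ℓ (Point.vertex G d) (Point.vertex G a) + walkLength ℓ p := by
      calc _ ≤ ((⨅ r : G.Walk c d, walkLength ℓ r) + ⨅ r : G.Walk d a, walkLength ℓ r) +
            ⨅ r : G.Walk a b, walkLength ℓ r :=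
          (iInf_walk_triangle ℓ c a b).trans (by gcongr; exact iInf_walk_triangle ℓ c d a)
        _ ≤ _ := by
          gcongr
          · exact iInf_le _ q.1
          · exact exists_walk_of_vertices ℓ d a
          · exact iInf_le _ p
    calc arcDist ℓ x z ≤ segmentLength ℓ x (Point.vertex G c) +
          (⨅ r : G.Walk c b, walkLength ℓ r) + segmentLength ℓ (Point.vertex G b) z := by
          simp only [ENNReal.iInf_add, ENNReal.add_iInf]
          exact le_iInf fun r => arcDist_le_through ℓ x z r
      _ ≤ segmentLength ℓ x (Point.vertex G c) + (walkLength ℓ q.1 +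
        segmentLength ℓ (Point.vertex G d) (Point.vertex G a) + walkLength ℓ p) +
          segmentLength ℓ (Point.vertex G b) z := by gcongr
      _ = _ := by ring
  refine h.trans ?_
  calc _ ≤ (segmentLength ℓ x y + segmentLength ℓ y (Point.vertex G a)) + walkLength ℓ p +
      segmentLength ℓ (Point.vertex G b) z := by
        gcongr; exact arcDist_le_segment_add ℓ x y _
    _ = _ := by ring

theorem arcDist_triangle (ℓ : G.edgeSet → ℝ) (x y z : Point G) :
    arcDist ℓ x z ≤ arcDist ℓ x y + arcDist ℓ y z := by
  have hseg : ∀ x y z : Point G, arcDist ℓ x z ≤ segmentLength ℓ x y + arcDist ℓ y z := by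
    intro x y z
    rw [arcDist.eq_1 ℓ y z, ← min_add_add_left]
    refine le_min (arcDist_le_segment_add ℓ x y z) ?_
    simp only [ENNReal.add_iInf]
    exact le_iInf fun a => le_iInf fun b => le_iInf fun p =>
      arcDist_le_segment_add_through ℓ x y z p.1
  rw [arcDist.eq_1 ℓ x y, ← min_add_add_right]
  refine le_min (hseg x y z) ?_
  simp only [ENNReal.iInf_add]
  refine le_iInf fun a => le_iInf fun b => le_iInf fun p => ?_
  have h : ∀ w, arcDist ℓ x z ≤ segmentLength ℓ x (Point.vertex G a) + walkLength ℓ p.1 + w →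
      w = arcDist ℓ (Point.vertex G b) z → arcDist ℓ x z ≤
      segmentLength ℓ x (Point.vertex G a) + walkLength ℓ p.1 +
        segmentLength ℓ (Point.vertex G b) y + arcDist ℓ y z := by
    intro w hw hwe
    refine hw.trans ?_
    rw [add_assoc _ _ (arcDist ℓ y z), hwe]
    gcongr
    exact hseg _ _ _
  refine h _ ?_ rfl
  rw [arcDist.eq_1 ℓ (Point.vertex G b) z, ← min_add_add_left]
  refine le_min (arcDist_le_through ℓ x z p.1) ?_
  simp only [ENNReal.add_iInf]
  refine le_iInf fun c => le_iInf fun d => le_iInf fun q => ?_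
  have h1 : (⨅ r : G.Walk a d, walkLength ℓ r) ≤ walkLength ℓ p.1 +
      segmentLength ℓ (Point.vertex G b) (Point.vertex G c) + walkLength ℓ q.1 := by
    calc _ ≤ ((⨅ r : G.Walk a b, walkLength ℓ r) + ⨅ r : G.Walk b c, walkLength ℓ r) +
          ⨅ r : G.Walk c d, walkLength ℓ r :=
        (iInf_walk_triangle ℓ a c d).trans (by gcongr; exact iInf_walk_triangle ℓ a b c)
      _ ≤ _ := by
        gcongr
        · exact iInf_le _ p.1
        · exact exists_walk_of_vertices ℓ b c
        · exact iInf_le _ q.1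
  calc arcDist ℓ x z ≤ segmentLength ℓ x (Point.vertex G a) +
        (⨅ r : G.Walk a d, walkLength ℓ r) + segmentLength ℓ (Point.vertex G d) z := by
        simp only [ENNReal.iInf_add, ENNReal.add_iInf]
        exact le_iInf fun r => arcDist_le_through ℓ x z r
    _ ≤ segmentLength ℓ x (Point.vertex G a) + (walkLength ℓ p.1 +
      segmentLength ℓ (Point.vertex G b) (Point.vertex G c) + walkLength ℓ q.1) +
        segmentLength ℓ (Point.vertex G d) z := by gcongr
    _ = _ := by ring

/-- The points of the 1-complex of `G`, carrying the pseudometric `d_ℓ`. -/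
def LengthSpace (_ : G.edgeSet → ℝ) : Type u := Point G

noncomputable instance (ℓ : G.edgeSet → ℝ) : PseudoEMetricSpace (LengthSpace ℓ) where
  edist x y := arcDist ℓ x y
  edist_self := arcDist_self ℓ
  edist_comm := arcDist_comm ℓ
  edist_triangle := arcDist_triangle ℓ

/-- The space `|G|_ℓ`: points at distance `0` are identified, and the resulting metric space is
completed. -/
abbrev LTop (ℓ : G.edgeSet → ℝ) : Type u :=
  UniformSpace.Completion (SeparationQuotient (LengthSpace ℓ))

/-- The canonical map from the 1-complex of `G` to `|G|_ℓ`. -/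
noncomputable def LTop.ofPoint (ℓ : G.edgeSet → ℝ) (x : Point G) : LTop ℓ :=
  ((SeparationQuotient.mk (show LengthSpace ℓ from x) : SeparationQuotient (LengthSpace ℓ)) :
    UniformSpace.Completion (SeparationQuotient (LengthSpace ℓ)))

/-! ### Vertex-ends and the space `MTOP(G)` -/

/-- A ray: a one-way infinite path. -/
structure Ray (G : SimpleGraph V) where
  vert : ℕ → V
  injective : Function.Injective vert
  adj : ∀ n, G.Adj (vert n) (vert (n + 1))

/-- The ray `R` has a tail in the set `C`. -/
def Ray.HasTailIn (R : Ray G) (C : Set V) : Prop := ∃ N, ∀ n, N ≤ n → R.vert n ∈ C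

/-- Vertex-equivalence of rays, no finite set of vertices separates them: for every finite set `S`
of vertices, both rays have a tail in the same component of `G - S`. -/
def Ray.Equivalent (R L : Ray G) : Prop :=
  ∀ S : Finset V, ∃ C : G.ComponentCompl (S : Set V),
    R.HasTailIn (C : Set V) ∧ L.HasTailIn (C : Set V)

theorem Ray.exists_tail_component (R : Ray G) (S : Finset V) :
    ∃ C : G.ComponentCompl (S : Set V), R.HasTailIn (C : Set V) := by
  have hfin : {n | R.vert n ∈ S}.Finite := S.finite_toSet.preimage R.injective.injOn
  obtain ⟨N, hN⟩ := hfin.bddAbove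
  have hout : ∀ n, N + 1 ≤ n → R.vert n ∉ (S : Set V) := by
    intro n hn hmem
    have : n ≤ N := hN hmem
    omega
  refine ⟨G.componentComplMk (hout (N + 1) le_rfl), N + 1, fun n hn => ?_⟩
  induction n, hn using Nat.le_induction with
  | base => exact SimpleGraph.componentComplMk_mem G _
  | succ n hn ih =>
    exact SimpleGraph.ComponentCompl.mem_of_adj _ _ ih (hout (n + 1) (by omega)) (R.adj n)

theorem Ray.tail_component_unique (R : Ray G) {S : Set V} {C D : G.ComponentCompl S}
    (hC : R.HasTailIn (C : Set V)) (hD : R.HasTailIn (D : Set V)) : C = D := by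
  obtain ⟨N, hN⟩ := hC
  obtain ⟨M, hM⟩ := hD
  obtain ⟨_, h1⟩ := hN (max N M) (le_max_left _ _)
  obtain ⟨_, h2⟩ := hM (max N M) (le_max_right _ _)
  exact h1.symm.trans h2

/-- Vertex-equivalence is an equivalence relation on rays. -/
instance raySetoid (G : SimpleGraph V) : Setoid (Ray G) where
  r := Ray.Equivalent
  iseqv :=
    { refl := fun R S => (R.exists_tail_component S).imp fun _ h => ⟨h, h⟩
      symm := fun h S => (h S).imp fun _ h => ⟨h.2, h.1⟩
      trans := fun {_ L _} h h' S => by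
        obtain ⟨C, h1, h2⟩ := h S
        obtain ⟨D, h3, h4⟩ := h' S
        rw [← L.tail_component_unique h2 h3] at h4
        exact ⟨C, h1, h4⟩ }

/-- The set `Ω(G)` of vertex-ends of `G`. -/
def VertexEnd (G : SimpleGraph V) : Type u := Quotient (raySetoid G)

/-- The vertex-end `ω` has a ray all of whose vertices lie in `C`. -/
def VertexEnd.HasRayIn (ω : VertexEnd G) (C : Set V) : Prop :=
  ∃ R : Ray G, Quotient.mk (raySetoid G) R = ω ∧ ∀ n, R.vert n ∈ C

/-- The vertex set of `C(S, ω)`, the unique component of `G - S` that contains a ray in `ω`. -/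
def endComponent (S : Finset V) (ω : VertexEnd G) : Set V :=
  {v | ∃ C : G.ComponentCompl (S : Set V), ω.HasRayIn (C : Set V) ∧ v ∈ C}

/-- The point set of `MTOP(G)`: the points of the 1-complex of `G` and the vertex-ends of `G`. -/
inductive MTop (G : SimpleGraph V) : Type u
  | point (x : Point G) : MTop G
  | vertexEnd (ω : VertexEnd G) : MTop G

/-- The points with coordinate in `U` of the open edge with ends `a` and `b`. -/
def MTop.edgePart (G : SimpleGraph V) (a b : V) (U : Set ℝ) : Set (MTop G) :=
  {p | ∃ x : Point G, p = .point x ∧ x.InnerOf a b ∧ x.coord a ∈ U}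

/-- The open star of radius `ε < 1` around the vertex `v`; the distance of `v` from a point `x` of
an edge at `v` is `1 - x.coord v`, every edge having length `1`. -/
def MTop.openStar (G : SimpleGraph V) (v : V) (ε : ℝ) : Set (MTop G) :=
  {p | ∃ x : Point G, p = .point x ∧ 1 - x.coord v < ε}

/-- The set `Ĉ_ε(S, ω)`. It consists of the points of the component `C(S, ω)`, of the vertex-ends
with a ray in `C(S, ω)`, and of the inner points of the edges `sc` with `s ∈ S` and `c ∈ C(S, ω)`
whose distance from `c` is less than `ε`, every edge having length `1`. -/
def MTop.endNhd (S : Finset V) (ω : VertexEnd G) (ε : ℝ) : Set (MTop G) :=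
  {p | ∃ x : Point G, p = .point x ∧ ∀ v, x.coord v ≠ 0 → v ∈ endComponent S ω} ∪
  {p | ∃ ω' : VertexEnd G, p = .vertexEnd ω' ∧ ω'.HasRayIn (endComponent S ω)} ∪
  {p | ∃ x : Point G, p = .point x ∧ ∃ s ∈ S, ∃ c ∈ endComponent S ω,
    x.InnerOf s c ∧ 1 - x.coord c < ε}

/-- The topology of `MTOP(G)`. -/
instance (G : SimpleGraph V) : TopologicalSpace (MTop G) :=
  TopologicalSpace.generateFrom
    ({A | ∃ a b : V, ∃ U : Set ℝ, IsOpen U ∧ A = MTop.edgePart G a b U} ∪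
     {A | ∃ v : V, ∃ ε : ℝ, 0 < ε ∧ ε < 1 ∧ A = MTop.openStar G v ε} ∪
     {A | ∃ (S : Finset V) (ω : VertexEnd G) (ε : ℝ), 0 < ε ∧ A = MTop.endNhd S ω ε})

/-- `X ≈_A X'`: for two spaces `X`, `X'` containing the points of `A` by means of `i` and `j`, the
identity on `A` extends to a homeomorphism between `X` and `X'`. -/
def HomeomorphicOver {A X X' : Type u} [TopologicalSpace X] [TopologicalSpace X']
    (i : A → X) (j : A → X') : Prop :=
  ∃ h : X ≃ₜ X', ∀ a, h (i a) = j a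

end GraphCompletion

/-! One direction is immediate: `LTop ℓ` is a metric space because `G` is connected, and
metrizability passes through a homeomorphism.

For the converse, a metric on `MTop G` yields a normal spanning tree, and the tree yields the
lengths. A vertex has positive distance from the set of all ends, since its open star contains no
end. Bounding that distance below by `1 / (n + 1)` with `n` least gives the vertex its rank. A small
ball around an end contains all vertices of some `C(S, ω)`, so the vertices of rank at most `k` are
separated from `ω` by a finite set (`exists_rank`). By Jung's argument such ranks give a normal
spanning tree (`exists_normalTree`). The tree is grown by a search that always heads for a vertex of
least rank in the current component. If the search missed `v`, it would trace a ray, and infinitely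
many of its targets, all of rank at most `r v`, would stay close to the end of that ray
(`exists_search_eq`).

Given the tree, a vertex of level `n` has height `2⁻ⁿ`, and the length of an edge is the difference
of the heights of its ends. Branches then have finite length, so they converge. Edges that leave the
up-set of `t` have length at least the height of `t`, because they end strictly below `t`. Hence the
coordinates of a point, and its total coordinate in each up-set (`Point.mass`), are Lipschitz and
extend to the completion. Sending every end to the limit of its branch defines a map from `MTop G`
to `LTop T.len`. The extended functions show that it is injective and inducing, and that the
completion adds nothing but the limits of branches. -/

namespace GraphCompletion

variable {V : Type u} {G : SimpleGraph V}

/-! ### Walks inside a vertex set, rays, and the components `C(S, ω)` -/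

/-- `v` and `w` are joined by a walk all of whose vertices lie in `A`. -/
def Linked (G : SimpleGraph V) (A : Set V) (v w : V) : Prop :=
  ∃ p : G.Walk v w, ∀ x ∈ p.support, x ∈ A

namespace Linked

variable {A B : Set V} {v w x : V}

theorem mem_right (h : Linked G A v w) : w ∈ A := by
  obtain ⟨p, hp⟩ := h
  exact hp w p.end_mem_support

theorem refl (h : v ∈ A) : Linked G A v v := ⟨.nil, by simpa using h⟩

theorem symm (h : Linked G A v w) : Linked G A w v := by
  obtain ⟨p, hp⟩ := h
  exact ⟨p.reverse, by simpa using hp⟩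

theorem trans (h : Linked G A v w) (h' : Linked G A w x) : Linked G A v x := by
  obtain ⟨p, hp⟩ := h
  obtain ⟨q, hq⟩ := h'
  refine ⟨p.append q, fun y hy => ?_⟩
  rcases SimpleGraph.Walk.mem_support_append_iff _ _ |>.1 hy with hy | hy
  exacts [hp y hy, hq y hy]

theorem mono (hAB : A ⊆ B) (h : Linked G A v w) : Linked G B v w :=
  h.imp fun _ hp y hy => hAB (hp y hy)

theorem of_adj (hv : v ∈ A) (hw : w ∈ A) (h : G.Adj v w) : Linked G A v w :=
  ⟨.cons h .nil, by simp [hv, hw]⟩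

theorem mem_component {S : Set V} {C : G.ComponentCompl S} (hv : v ∈ C)
    (h : Linked G Sᶜ v w) : w ∈ C := by
  obtain ⟨p, hp⟩ := h
  induction p with
  | nil => exact hv
  | cons h p ih =>
    simp only [SimpleGraph.Walk.support_cons, List.mem_cons, forall_eq_or_imp] at hp
    exact ih (SimpleGraph.ComponentCompl.mem_of_adj _ _ hv (hp.2 _ p.start_mem_support) h) hp.2

theorem of_mem_component {S : Set V} {C : G.ComponentCompl S} (hv : v ∈ C) (hw : w ∈ C) :
    Linked G Sᶜ v w := by
  obtain ⟨hv, rfl⟩ := hv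
  obtain ⟨hw, h⟩ := hw
  obtain ⟨p⟩ := SimpleGraph.ConnectedComponent.exact h.symm
  have key : ∀ {a b : (Sᶜ : Set V)}, (G.induce Sᶜ).Walk a b → Linked G Sᶜ a b := by
    intro a b p
    induction p with
    | nil => exact .refl (Subtype.prop _)
    | cons h p ih => exact (of_adj (Subtype.prop _) (Subtype.prop _) h).trans ih
  exact key p

end Linked

/-- The tail of a ray. -/
def Ray.shift (R : Ray G) (N : ℕ) : Ray G where
  vert n := R.vert (N + n)
  injective _ _ h := by simpa using R.injective h
  adj n := R.adj (N + n)

theorem Ray.mk_shift (R : Ray G) (N : ℕ) :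
    Quotient.mk (raySetoid G) (R.shift N) = Quotient.mk (raySetoid G) R := by
  refine Quotient.sound fun S => ?_
  obtain ⟨C, M, hM⟩ := R.exists_tail_component S
  exact ⟨C, ⟨M, fun n hn => hM _ (by omega)⟩, M, hM⟩

theorem Ray.HasTailIn.hasRayIn {R : Ray G} {A : Set V} (h : R.HasTailIn A) :
    VertexEnd.HasRayIn (Quotient.mk (raySetoid G) R) A := by
  obtain ⟨N, hN⟩ := h
  exact ⟨R.shift N, R.mk_shift N, fun n => hN _ (by omega)⟩

theorem Ray.HasTailIn.mono {R : Ray G} {A B : Set V} (h : R.HasTailIn A) (hAB : A ⊆ B) :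
    R.HasTailIn B := by
  obtain ⟨N, hN⟩ := h
  exact ⟨N, fun n hn => hAB (hN n hn)⟩

theorem VertexEnd.HasRayIn.mono {ω : VertexEnd G} {A B : Set V} (h : ω.HasRayIn A) (hAB : A ⊆ B) :
    ω.HasRayIn B := by
  obtain ⟨R, hR, h⟩ := h
  exact ⟨R, hR, fun n => hAB (h n)⟩

/-- Equivalent rays have tails in the same component of `G - S`, so the union that defines
`endComponent` has only one member. -/
theorem endComponent_eq {S : Finset V} {ω : VertexEnd G} {C : G.ComponentCompl (S : Set V)}
    (h : ω.HasRayIn (C : Set V)) : endComponent S ω = C := by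
  ext v
  refine ⟨fun ⟨D, hD, hv⟩ => ?_, fun hv => ⟨C, h, hv⟩⟩
  obtain ⟨R, rfl, hR⟩ := h
  obtain ⟨L, hLR, hL⟩ := hD
  obtain ⟨E, h1, h2⟩ := Quotient.exact hLR S
  have e1 := L.tail_component_unique ⟨0, fun n _ => hL n⟩ h1
  have e2 := R.tail_component_unique ⟨0, fun n _ => hR n⟩ h2
  rw [e2, ← e1]
  exact hv

theorem exists_endComponent_eq (S : Finset V) (ω : VertexEnd G) :
    ∃ C : G.ComponentCompl (S : Set V), endComponent S ω = C ∧ ω.HasRayIn (C : Set V) := by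
  induction ω using Quotient.inductionOn with
  | _ R =>
    obtain ⟨C, hC⟩ := R.exists_tail_component S
    exact ⟨C, endComponent_eq hC.hasRayIn, hC.hasRayIn⟩

theorem hasTailIn_endComponent (S : Finset V) (R : Ray G) :
    R.HasTailIn (endComponent S (Quotient.mk (raySetoid G) R)) := by
  obtain ⟨C, hC⟩ := R.exists_tail_component S
  rw [endComponent_eq hC.hasRayIn]
  exact hC

theorem mem_endComponent_of_linked {S : Finset V} {ω : VertexEnd G} {v w : V}
    (hv : v ∈ endComponent S ω) (h : Linked G (S : Set V)ᶜ v w) : w ∈ endComponent S ω := by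
  obtain ⟨C, hC, hv⟩ := hv
  exact ⟨C, hC, h.mem_component hv⟩

theorem notMem_of_mem_endComponent {S : Finset V} {ω : VertexEnd G} {v : V}
    (hv : v ∈ endComponent S ω) : v ∉ S := by
  obtain ⟨C, hC, hv⟩ := hv
  exact SimpleGraph.ComponentCompl.notMem_of_mem hv

theorem endComponent_eq_of_hasRayIn {S : Finset V} {ω ω' : VertexEnd G}
    (h : ω'.HasRayIn (endComponent S ω)) : endComponent S ω' = endComponent S ω := by
  obtain ⟨C, hC, -⟩ := exists_endComponent_eq S ω
  rw [hC] at h ⊢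
  exact endComponent_eq h

theorem endComponent_anti {S T : Finset V} (hST : S ⊆ T) (ω : VertexEnd G) :
    endComponent T ω ⊆ endComponent S ω := by
  intro v hv
  obtain ⟨C, hC, R, rfl, hR⟩ := exists_endComponent_eq T ω
  rw [hC] at hv
  obtain ⟨N, hN⟩ := hasTailIn_endComponent S R
  exact mem_endComponent_of_linked (hN N le_rfl)
    ((Linked.of_mem_component (hR N) hv).mono (by simpa using hST))

/-! ### Ranks of vertices from a metric on `MTOP(G)` -/

/-- A neighbourhood of a vertex-end contains all vertices of some component `C(S, ω)`. -/
theorem exists_endComponent_subset {U : Set (MTop G)} (hU : IsOpen U) {ω : VertexEnd G}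
    (hω : MTop.vertexEnd ω ∈ U) :
    ∃ S : Finset V, ∀ v ∈ endComponent S ω, MTop.point (Point.vertex G v) ∈ U := by
  classical
  induction hU with
  | basic A hA =>
    rcases hA with (⟨a, b, W, hW, rfl⟩ | ⟨v, ε, h0, h1, rfl⟩) | ⟨S, ω', ε, h0, rfl⟩
    · obtain ⟨x, hx, -⟩ := hω
      cases hx
    · obtain ⟨x, hx, -⟩ := hω
      cases hx
    · refine ⟨S, fun v hv => Or.inl (Or.inl ⟨_, rfl, fun w hw => ?_⟩)⟩
      have hwv : w = v := by
        by_contra h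
        exact hw (by simp [Point.vertex, h])
      subst hwv
      rcases hω with (⟨x, hx, -⟩ | ⟨ω'', hx, h⟩) | ⟨x, hx, -⟩
      · cases hx
      · cases hx
        rwa [← endComponent_eq_of_hasRayIn h]
      · cases hx
  | univ => exact ⟨∅, fun v _ => trivial⟩
  | inter A B _ _ hA hB =>
    obtain ⟨S, hS⟩ := hA hω.1
    obtain ⟨T, hT⟩ := hB hω.2
    exact ⟨S ∪ T, fun v hv => ⟨hS v (endComponent_anti Finset.subset_union_left ω hv),
      hT v (endComponent_anti Finset.subset_union_right ω hv)⟩⟩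
  | sUnion 𝒜 _ h =>
    obtain ⟨A, hA, hωA⟩ := hω
    obtain ⟨S, hS⟩ := h A hA hωA
    exact ⟨S, fun v hv => ⟨A, hA, hS v hv⟩⟩

/-- If `MTOP(G)` is metrizable, then `V` is a countable union of sets (here: the sets of vertices
of given rank) each of which can be separated from every end by finitely many vertices. -/
theorem exists_rank [TopologicalSpace.MetrizableSpace (MTop G)] :
    ∃ r : V → ℕ, ∀ (ω : VertexEnd G) (k : ℕ), ∃ S : Finset V, ∀ v ∈ endComponent S ω, k < r v := by
  classical
  let _ : MetricSpace (MTop G) := TopologicalSpace.metrizableSpaceMetric (MTop G)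
  -- The open star around `v` contains no ends, so a ball around `v` inside it keeps all ends at a
  -- uniform distance.
  have key : ∀ v : V, ∃ n : ℕ, ∀ ω : VertexEnd G,
      1 / ((n : ℝ) + 1) ≤ dist (MTop.point (Point.vertex G v)) (MTop.vertexEnd ω) := by
    intro v
    have ho : IsOpen (MTop.openStar G v (1 / 2)) :=
      TopologicalSpace.isOpen_generateFrom_of_mem
        (Or.inl (Or.inr ⟨v, 1 / 2, by norm_num, by norm_num, rfl⟩))
    obtain ⟨ε, hε, hb⟩ := Metric.isOpen_iff.1 ho (MTop.point (Point.vertex G v))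
      ⟨_, rfl, by simp [Point.vertex]⟩
    obtain ⟨n, hn⟩ := exists_nat_one_div_lt hε
    refine ⟨n, fun ω => le_of_not_gt fun hlt => ?_⟩
    obtain ⟨x, hx, -⟩ := hb (Metric.mem_ball'.2 (hlt.trans hn))
    cases hx
  refine ⟨fun v => Nat.find (key v), fun ω k => ?_⟩
  obtain ⟨S, hS⟩ := exists_endComponent_subset
    (Metric.isOpen_ball (x := MTop.vertexEnd ω) (ε := 1 / ((k : ℝ) + 1)))
    (Metric.mem_ball_self (by positivity))
  refine ⟨S, fun v hv => lt_of_not_ge fun hle => ?_⟩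
  have h1 := Metric.mem_ball.1 (hS v hv)
  have h2 := Nat.find_spec (key v) ω
  have h3 : 1 / ((k : ℝ) + 1) ≤ 1 / ((Nat.find (key v) : ℝ) + 1) := by
    gcongr
  linarith

/-! ### Normal spanning trees by search -/

/-- A normal spanning tree of `G`, given by its tree order: the ends of every edge of `G` are
comparable, and the tree edges (between `a` and its successor below `b`) are edges of `G`. -/
structure NormalTree (G : SimpleGraph V) where
  le : V → V → Prop
  lev : V → ℕ
  root : V
  refl : ∀ a, le a a
  trans : ∀ {a b c}, le a b → le b c → le a c
  root_le : ∀ a, le root a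
  lev_root : lev root = 0
  lev_lt : ∀ {a b}, le a b → a ≠ b → lev a < lev b
  chain : ∀ {a b c}, le a c → le b c → le a b ∨ le b a
  adj_comp : ∀ {a b}, G.Adj a b → le a b ∨ le b a
  exists_child : ∀ {a b}, le a b → a ≠ b →
    ∃ c, G.Adj a c ∧ lev c = lev a + 1 ∧ le a c ∧ le c b

section Construction

/-- Reducing the walk to a path makes it leave `a` for good after its first edge. -/
theorem exists_shorter_walk {A : Set V} {a b : V} (p : G.Walk a b) (hp : ∀ x ∈ p.support, x ∈ A)
    (hab : a ≠ b) : ∃ y, G.Adj a y ∧ ∃ q : G.Walk y b, (∀ x ∈ q.support, x ∈ A \ {a}) ∧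
      q.length < p.length := by
  classical
  have hb : ∀ x ∈ p.bypass.support, x ∈ A := fun x hx => hp x (p.support_bypass_subset_support hx)
  have hl := p.length_bypass_le_length
  have hpath := p.bypass_isPath
  generalize p.bypass = p' at hb hl hpath
  cases p' with
  | nil => exact absurd rfl hab
  | @cons _ y _ h q =>
    rw [SimpleGraph.Walk.cons_isPath_iff] at hpath
    simp only [SimpleGraph.Walk.length_cons] at hl
    refine ⟨y, h, q, fun x hx => ⟨hb x (by simp [hx]), ?_⟩, by omega⟩
    rintro rfl
    exact hpath.2 hx

theorem Linked.exists_adj {A : Set V} {a b : V} (h : Linked G A a b) (hab : a ≠ b) :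
    ∃ y, G.Adj a y ∧ Linked G (A \ {a}) y b := by
  obtain ⟨p, hp⟩ := h
  obtain ⟨y, hy, q, hq, -⟩ := exists_shorter_walk p hp hab
  exact ⟨y, hy, q, hq⟩

theorem Linked.linked_class {A : Set V} {v w : V} (h : Linked G A v w) :
    Linked G {x | Linked G A v x} v w := by
  classical
  obtain ⟨p, hp⟩ := h
  refine ⟨p, fun x hx => ⟨p.takeUntil x hx, fun y hy => hp y ?_⟩⟩
  exact p.support_takeUntil_subset_support hx hy

/-- A choice of elements of least rank that is stable under shrinking the set. -/
theorem exists_target [Nonempty V] (r : V → ℕ) : ∃ μ : Set V → V, (∀ C v, v ∈ C → μ C ∈ C) ∧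
    (∀ C D, D ⊆ C → μ C ∈ D → μ D = μ C) ∧ ∀ C v, v ∈ C → r (μ C) ≤ r v := by
  classical
  -- Ties in rank are broken by a well-ordering of `V`. The minimum of a set is then unique, and so
  -- remains the minimum of every subset that contains it.
  let lt : V → V → Prop := InvImage (Prod.Lex (· < ·) WellOrderingRel) fun v => (r v, v)
  have wf : WellFounded lt :=
    InvImage.wf _ (WellFounded.prod_lex Nat.lt_wfRel.wf WellOrderingRel.isWellOrder.wf)
  have tri : ∀ a b : V, ¬ lt a b → ¬ lt b a → a = b := by
    intro a b h1 h2
    simp only [lt, InvImage, Prod.lex_def, not_or, not_and, not_lt] at h1 h2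
    have e := le_antisymm h2.1 h1.1
    rcases trichotomous_of WellOrderingRel a b with h | h | h
    exacts [absurd h (h1.2 e), h, absurd h (h2.2 e.symm)]
  refine ⟨fun C => if h : C.Nonempty then wf.min C h else Classical.arbitrary V, ?_, ?_, ?_⟩
  · intro C v hv
    have h : C.Nonempty := ⟨v, hv⟩
    simp only [h, dif_pos]
    exact wf.min_mem _ _
  · intro C D hDC hD
    have h1 : D.Nonempty := ⟨_, hD⟩
    have h2 : C.Nonempty := h1.mono hDC
    simp only [h1, h2, dif_pos] at hD ⊢
    exact tri _ _ (wf.not_lt_min _ (hDC (wf.min_mem _ _))) (wf.not_lt_min _ hD)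
  · intro C v hv
    have h : C.Nonempty := ⟨v, hv⟩
    simp only [h, dif_pos]
    have := wf.not_lt_min C hv
    simp only [lt, InvImage, Prod.lex_def, not_or, not_lt] at this
    exact this.1

/-- `ν t C` is a neighbour of `t` in `C` that is as close as possible to `μ C` inside `C`. -/
def IsNext (G : SimpleGraph V) (μ : Set V → V) (ν : V → Set V → V) : Prop :=
  ∀ t C, (∃ y ∈ C, G.Adj t y) → (∀ y ∈ C, Linked G C y (μ C)) →
    ν t C ∈ C ∧ G.Adj t (ν t C) ∧ ∀ y ∈ C, G.Adj t y → ∀ q : G.Walk y (μ C),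
      (∀ x ∈ q.support, x ∈ C) →
        ∃ p : G.Walk (ν t C) (μ C), (∀ x ∈ p.support, x ∈ C) ∧ p.length ≤ q.length

theorem exists_next (G : SimpleGraph V) (μ : Set V → V) : ∃ ν, IsNext G μ ν := by
  classical
  have key : ∀ (t : V) (C : Set V), ∃ z : V, (∃ y ∈ C, G.Adj t y) →
      (∀ y ∈ C, Linked G C y (μ C)) →
      z ∈ C ∧ G.Adj t z ∧ ∀ y ∈ C, G.Adj t y → ∀ q : G.Walk y (μ C),
        (∀ x ∈ q.support, x ∈ C) →
          ∃ p : G.Walk z (μ C), (∀ x ∈ p.support, x ∈ C) ∧ p.length ≤ q.length := by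
    intro t C
    by_cases h : (∃ y ∈ C, G.Adj t y) ∧ ∀ y ∈ C, Linked G C y (μ C)
    · obtain ⟨⟨y, hyC, hty⟩, hl⟩ := h
      have hex : ∃ n : ℕ, ∃ z ∈ C, G.Adj t z ∧ ∃ p : G.Walk z (μ C),
          (∀ x ∈ p.support, x ∈ C) ∧ p.length = n := by
        obtain ⟨p, hp⟩ := hl y hyC
        exact ⟨_, y, hyC, hty, p, hp, rfl⟩
      obtain ⟨z, hz, htz, p, hp, hpl⟩ := Nat.find_spec hex
      refine ⟨z, fun _ _ => ⟨hz, htz, fun y hy hty q hq => ⟨p, hp, ?_⟩⟩⟩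
      rw [hpl]
      exact Nat.find_min' hex ⟨y, hy, hty, q, hq, rfl⟩
    -- If `t` has no neighbour in `C`, or `C` is not linked to its target, nothing is required and
    -- `t` serves as a dummy value.
    · exact ⟨t, fun h1 h2 => absurd ⟨h1, h2⟩ h⟩
  choose ν hν using key
  exact ⟨ν, hν⟩

/-- The search for `v`: start with `root` and `G`; at each step delete the current vertex, pass to
the component that contains `v`, and choose the next vertex there by means of `ν`. -/
def search (G : SimpleGraph V) (ν : V → Set V → V) (root v : V) : ℕ → V × Set V
  | 0 => (root, Set.univ)
  | n + 1 =>
    (ν (search G ν root v n).1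
        {w | Linked G ((search G ν root v n).2 \ {(search G ν root v n).1}) v w},
      {w | Linked G ((search G ν root v n).2 \ {(search G ν root v n).1}) v w})

variable {μ : Set V → V} {ν : V → Set V → V} {root : V}

theorem search_succ_subset {v : V} {n : ℕ} : (search G ν root v (n + 1)).2 ⊆
    (search G ν root v n).2 \ {(search G ν root v n).1} := fun _ hw => hw.mem_right

theorem search_anti {v : V} {m n : ℕ} (h : m ≤ n) :
    (search G ν root v n).2 ⊆ (search G ν root v m).2 := by
  induction h with
  | refl => exact subset_rfl
  | step _ ih => exact (search_succ_subset.trans Set.sdiff_subset).trans ih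

/-- The searches for two vertices coincide until the vertices are separated. This is what makes all
the searches fit together into one tree. -/
theorem search_eq {v w : V} {n : ℕ} (h : w ∈ (search G ν root v n).2) :
    search G ν root w n = search G ν root v n := by
  induction n with
  | zero => rfl
  | succ n ih =>
    have e := ih (search_succ_subset h).1
    have e' : {x | Linked G ((search G ν root v n).2 \ {(search G ν root v n).1}) w x} =
        {x | Linked G ((search G ν root v n).2 \ {(search G ν root v n).1}) v x} := by
      ext x
      exact ⟨fun hx => Linked.trans h hx, fun hx => (Linked.symm h).trans hx⟩
    simp only [search, e, e']

theorem search_linked (hG : G.Connected) {v x y : V} {n : ℕ} (hx : x ∈ (search G ν root v n).2)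
    (hy : y ∈ (search G ν root v n).2) : Linked G (search G ν root v n).2 x y := by
  cases n with
  | zero =>
    obtain ⟨p⟩ := hG.preconnected x y
    exact ⟨p, fun _ _ => trivial⟩
  | succ n => exact (Linked.linked_class hx).symm.trans (Linked.linked_class hy)

/-- The previous component is linked, so a walk in it from the deleted vertex to `v` provides a
neighbour of the deleted vertex in the component of `v`. Thus the requirement on `ν` is not vacuous.
-/
theorem search_top_mem (hG : G.Connected) (hμ : ∀ C v, v ∈ C → μ C ∈ C) (hν : IsNext G μ ν)
    {v : V} {n : ℕ} (hv : v ∈ (search G ν root v n).2) :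
    (search G ν root v n).1 ∈ (search G ν root v n).2 := by
  induction n with
  | zero => trivial
  | succ n ih =>
    have hv' := (search_succ_subset hv)
    obtain ⟨y, hy, hl⟩ := (search_linked hG (ih hv'.1) hv'.1).exists_adj (Ne.symm hv'.2)
    exact (hν _ _ ⟨y, hl.symm, hy⟩ fun z hz =>
      search_linked (n := n + 1) hG hz (hμ _ v hv)).1

theorem search_next (hG : G.Connected) (hμ : ∀ C v, v ∈ C → μ C ∈ C) (hν : IsNext G μ ν)
    {v : V} {n : ℕ} (hv : v ∈ (search G ν root v (n + 1)).2) :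
    G.Adj (search G ν root v n).1 (search G ν root v (n + 1)).1 ∧
    ∀ y ∈ (search G ν root v (n + 1)).2, G.Adj (search G ν root v n).1 y →
      ∀ q : G.Walk y (μ (search G ν root v (n + 1)).2),
      (∀ x ∈ q.support, x ∈ (search G ν root v (n + 1)).2) →
      ∃ p : G.Walk (search G ν root v (n + 1)).1 (μ (search G ν root v (n + 1)).2),
        (∀ x ∈ p.support, x ∈ (search G ν root v (n + 1)).2) ∧ p.length ≤ q.length := by
  have hv' := (search_succ_subset hv)
  obtain ⟨y, hy, hl⟩ := (search_linked hG (search_top_mem hG hμ hν hv'.1) hv'.1).exists_adj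
    (Ne.symm hv'.2)
  exact (hν _ _ ⟨y, hl.symm, hy⟩ fun z hz =>
      search_linked (n := n + 1) hG hz (hμ _ v hv)).2

/-- While `v` has not been found, every target is eventually found or cut off. -/
theorem exists_target_lost (hG : G.Connected) (hμ : ∀ C v, v ∈ C → μ C ∈ C)
    (hstab : ∀ C D, D ⊆ C → μ C ∈ D → μ D = μ C) (hν : IsNext G μ ν) {v : V}
    (hv : ∀ n, v ∈ (search G ν root v n).2) (n : ℕ) :
    ∃ m, n ≤ m ∧ μ (search G ν root v m).2 ∉ (search G ν root v (m + 1)).2 := by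
  by_contra! hcon
  -- If no target were lost from stage `n` on, stability would make the target constant. The walk to
  -- it from the current vertex would get shorter at every step, until the target itself is the
  -- current vertex and is deleted.
  have hstep : ∀ m, n ≤ m → μ (search G ν root v (m + 1)).2 = μ (search G ν root v m).2 :=
    fun m hm => hstab _ _ (search_succ_subset.trans Set.sdiff_subset) (hcon m hm)
  have key : ∀ L m, n ≤ m → ∀ p : G.Walk (search G ν root v m).1 (μ (search G ν root v m).2),
      (∀ x ∈ p.support, x ∈ (search G ν root v m).2) → p.length ≤ L → False := by
    intro L
    induction L with
    | zero =>
      intro m hm p _ hl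
      have h := SimpleGraph.Walk.eq_of_length_eq_zero (Nat.le_zero.1 hl)
      exact (search_succ_subset (hcon m hm)).2 h.symm
    | succ L ih =>
      intro m hm p hp hl
      have hc := hcon m hm
      have hne : (search G ν root v m).1 ≠ μ (search G ν root v m).2 :=
        fun h => (search_succ_subset hc).2 h.symm
      obtain ⟨y, hy, q, hq, hql⟩ := exists_shorter_walk p hp hne
      have hqC : ∀ x ∈ q.support, x ∈ (search G ν root v (m + 1)).2 := by
        intro x hx
        classical
        refine Linked.trans hc (Linked.symm ⟨q.dropUntil x hx, fun z hz => hq z ?_⟩)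
        exact q.support_dropUntil_subset_support hx hz
      -- The next vertex need not be `y`, but by the choice of `ν` it is no farther from the target
      -- than `y` is along `q`.
      have := (search_next hG hμ hν (hv (m + 1))).2 y (hqC y q.start_mem_support) hy
      rw [hstep m hm] at this
      obtain ⟨p', hp', hl'⟩ := this q hqC
      refine ih (m + 1) (by omega) (p'.copy rfl (hstep m hm).symm) ?_ ?_
      · simpa using hp'
      · simp only [SimpleGraph.Walk.length_copy]; omega
  obtain ⟨p, hp⟩ := search_linked hG (search_top_mem hG hμ hν (hv n)) (hμ _ v (hv n))
  exact key _ n le_rfl p hp le_rfl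

/-- Otherwise the current vertices form a ray. For its end `ω` there is a finite `S` such that all
vertices of `C(S, ω)` have rank greater than `r v`. The components all contain `v`, so the targets
have rank at most `r v`. But a target lost late enough is joined to the ray outside `S`, and so lies
in `C(S, ω)`. -/
theorem exists_search_eq (hG : G.Connected) (hμ : ∀ C v, v ∈ C → μ C ∈ C)
    (hstab : ∀ C D, D ⊆ C → μ C ∈ D → μ D = μ C) {r : V → ℕ}
    (hμr : ∀ C v, v ∈ C → r (μ C) ≤ r v) (hν : IsNext G μ ν)
    (hr : ∀ (ω : VertexEnd G) (k : ℕ), ∃ S : Finset V, ∀ v ∈ endComponent S ω, k < r v) (v : V) :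
    ∃ n, (search G ν root v n).1 = v := by
  by_contra! hcon
  have hv : ∀ n, v ∈ (search G ν root v n).2 := by
    intro n
    induction n with
    | zero => trivial
    | succ n ih => exact Linked.refl ⟨ih, fun h => hcon n h.symm⟩
  have htop := fun n => search_top_mem hG hμ hν (hv n)
  have hnot : ∀ m n, m < n → (search G ν root v m).1 ∉ (search G ν root v n).2 :=
    fun m n hmn h => (search_succ_subset (search_anti hmn h)).2 rfl
  let R : Ray G :=
    { vert := fun n => (search G ν root v n).1
      injective := by
        intro m n hmn
        dsimp only at hmn
        rcases lt_trichotomy m n with h | h | h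
        · exact absurd (by rw [hmn]; exact htop n) (hnot m n h)
        · exact h
        · exact absurd (by rw [← hmn]; exact htop m) (hnot n m h)
      adj := fun n => (search_next hG hμ hν (hv (n + 1))).1 }
  obtain ⟨S, hS⟩ := hr (Quotient.mk _ R) (r v)
  obtain ⟨N, hN⟩ := hasTailIn_endComponent S R
  -- The components decrease, so each of the finitely many vertices of `S` is lost at most once;
  -- from stage `M` on none is.
  have hbound : ∃ M, ∀ s ∈ S, ∀ m, M ≤ m →
      s ∈ (search G ν root v m).2 → s ∈ (search G ν root v (m + 1)).2 := by
    clear hS hN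
    induction S using Finset.cons_induction with
    | empty => exact ⟨0, by simp⟩
    | cons a S _ ih =>
      obtain ⟨M, hM⟩ := ih
      have : ∃ M', ∀ m, M' ≤ m →
          a ∈ (search G ν root v m).2 → a ∈ (search G ν root v (m + 1)).2 := by
        by_cases h : ∀ m, a ∈ (search G ν root v m).2
        · exact ⟨0, fun m _ _ => h (m + 1)⟩
        · push Not at h
          obtain ⟨m, hm⟩ := h
          exact ⟨m, fun k hk h => absurd (search_anti hk h) hm⟩
      obtain ⟨M', hM'⟩ := this
      refine ⟨max M M', fun s hs m hm => ?_⟩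
      rcases Finset.mem_cons.1 hs with rfl | hs
      · exact hM' m (le_trans (le_max_right _ _) hm)
      · exact hM s hs m (le_trans (le_max_left _ _) hm)
  obtain ⟨M, hM⟩ := hbound
  obtain ⟨m, hm, hlost⟩ := exists_target_lost hG hμ hstab hν hv (max N M)
  -- The current vertex and all vertices of a path from it to the lost target drop out at this very
  -- step: one that survived would keep the target in the component of `v`. By the choice of `M`
  -- none of them lies in `S`.
  have hmem : Linked G (S : Set V)ᶜ (search G ν root v m).1 (μ (search G ν root v m).2) := by
    have hsep : ∀ x ∈ (search G ν root v m).2, x ∉ (search G ν root v (m + 1)).2 → x ∉ S :=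
      fun x hx hx' hxS => hx' (hM x hxS m (le_trans (le_max_right _ _) hm) hx)
    have h1 : (search G ν root v m).1 ∉ S := hsep _ (htop m) (hnot m _ (Nat.lt_succ_self m))
    by_cases heq : (search G ν root v m).1 = μ (search G ν root v m).2
    · rw [← heq]
      exact Linked.refl h1
    · obtain ⟨y, hy, q, hq⟩ := (search_linked hG (htop m) (hμ _ v (hv m))).exists_adj heq
      have hq' : ∀ x ∈ q.support, x ∉ S := by
        intro x hx
        classical
        refine hsep x (hq x hx).1 fun hxC => hlost (Linked.trans hxC ⟨q.dropUntil x hx,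
          fun z hz => hq z (q.support_dropUntil_subset_support hx hz)⟩)
      exact Linked.trans (Linked.of_adj h1 (hq' y q.start_mem_support) hy) ⟨q, hq'⟩
  have h1 := hS _ (mem_endComponent_of_linked (hN m (le_trans (le_max_left _ _) hm)) hmem)
  have h2 := hμr _ v (hv m)
  omega

end Construction

/-- Jung's criterion, from a rank function to a normal spanning tree. -/
theorem exists_normalTree (hG : G.Connected) {r : V → ℕ}
    (hr : ∀ (ω : VertexEnd G) (k : ℕ), ∃ S : Finset V, ∀ v ∈ endComponent S ω, k < r v) :
    Nonempty (NormalTree G) := by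
  classical
  have := hG.nonempty
  obtain ⟨μ, hμ, hstab, hμr⟩ := exists_target r
  obtain ⟨ν, hν⟩ := exists_next G μ
  obtain ⟨root⟩ := hG.nonempty
  have hex := exists_search_eq (root := root) hG hμ hstab hμr hν hr
  let s := search G ν root
  -- The level of `v` is the stage at which its search reaches it. The vertices below `b` are those
  -- visited by the search for `b` up to that stage.
  let lev : V → ℕ := fun v => Nat.find (hex v)
  have hlev : ∀ v, (s v (lev v)).1 = v := fun v => Nat.find_spec (hex v)
  have hmin : ∀ v n, n < lev v → (s v n).1 ≠ v := fun v n h => Nat.find_min (hex v) h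
  have hself : ∀ v n, n ≤ lev v → v ∈ (s v n).2 := by
    intro v n hn
    induction n with
    | zero => trivial
    | succ n ih => exact Linked.refl ⟨ih (by omega), fun h => hmin v n hn h.symm⟩
  have hself' : ∀ v n, v ∈ (s v n).2 → n ≤ lev v := by
    intro v n hv
    by_contra! h
    exact (search_succ_subset (search_anti h hv)).2 (hlev v).symm
  have hT : ∀ b n, n ≤ lev b → lev (s b n).1 = n ∧ ∀ m, m ≤ n → s (s b n).1 m = s b m := by
    intro b n hn
    have hmem := search_top_mem hG hμ hν (hself b n hn)
    have hm : ∀ m, m ≤ n → s (s b n).1 m = s b m := fun m h => search_eq (search_anti h hmem)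
    refine ⟨le_antisymm ?_ (hself' _ _ ?_), hm⟩
    · exact Nat.find_min' _ (congrArg Prod.fst (hm n le_rfl))
    · rw [hm n le_rfl]; exact hmem
  -- Normality: adjacent vertices lie in the same component until one of them is deleted, so the
  -- search for the later one passes through the earlier one.
  have hadj : ∀ a b, G.Adj a b → lev a ≤ lev b → ∀ n, n ≤ lev a → b ∈ (s a n).2 := by
    intro a b hab hl n hn
    induction n with
    | zero => trivial
    | succ n ih =>
      have hb := ih (by omega)
      refine Linked.of_adj ⟨hself a n (by omega), fun h => hmin a n hn h.symm⟩ ⟨hb, fun h => ?_⟩ hab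
      refine hmin b n (by omega) ?_
      rw [show s b n = s a n from search_eq hb]
      exact h.symm
  have hadj' : ∀ a b, G.Adj a b → lev a ≤ lev b → (s b (lev a)).1 = a := by
    intro a b hab hl
    rw [show s b (lev a) = s a (lev a) from search_eq (hadj a b hab hl _ le_rfl)]
    exact hlev a
  have hroot : lev root = 0 := (Nat.find_eq_zero _).2 rfl
  refine ⟨{ le := fun a b => lev a ≤ lev b ∧ (s b (lev a)).1 = a
            lev := lev
            root := root
            refl := fun a => ⟨le_rfl, hlev a⟩
            trans := ?_
            root_le := fun a => ⟨hroot ▸ Nat.zero_le _, by rw [hroot]; rfl⟩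
            lev_root := hroot
            lev_lt := ?_
            chain := ?_
            adj_comp := ?_
            exists_child := ?_ }⟩
  · rintro a b c ⟨h1, h2⟩ ⟨h3, h4⟩
    refine ⟨h1.trans h3, ?_⟩
    rw [← (hT c _ h3).2 _ h1, h4, h2]
  · rintro a b ⟨h1, h2⟩ hne
    refine lt_of_le_of_ne h1 fun h => hne ?_
    rw [← h2, h, hlev]
  · rintro a b c ⟨h1, h2⟩ ⟨h3, h4⟩
    rcases le_total (lev a) (lev b) with h | h
    · refine Or.inl ⟨h, ?_⟩
      conv_lhs => rw [← h4]
      rw [(hT c _ h3).2 _ h, h2]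
    · refine Or.inr ⟨h, ?_⟩
      conv_lhs => rw [← h2]
      rw [(hT c _ h1).2 _ h, h4]
  · intro a b hab
    rcases le_total (lev a) (lev b) with h | h
    · exact Or.inl ⟨h, hadj' a b hab h⟩
    · exact Or.inr ⟨h, hadj' b a hab.symm h⟩
  · rintro a b ⟨h1, h2⟩ hne
    have hlt : lev a < lev b := lt_of_le_of_ne h1 fun h => hne (by rw [← h2, h, hlev])
    obtain ⟨hc, hc'⟩ := hT b (lev a + 1) hlt
    refine ⟨(s b (lev a + 1)).1, ?_, hc, ⟨by omega, ?_⟩, ⟨by omega, by rw [hc]⟩⟩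
    · have := (search_next hG hμ hν (hself b (lev a + 1) hlt)).1
      rwa [show (search G ν root b (lev a)).1 = a from h2] at this
    · rw [hc' _ (Nat.le_succ _), h2]

/-! ### Coordinates of points and their sums over vertex sets -/

namespace Point

theorem coord_nonneg (x : Point G) (w : V) : 0 ≤ x.coord w := by
  rcases x.mem with ⟨a, h1, h0⟩ | ⟨a, b, -, ha, hb, -, h0⟩
  · by_cases h : w = a
    · subst h; simp [h1]
    · simp [h0 w h]
  · by_cases h : w = a
    · subst h; exact ha.le
    · by_cases h' : w = b
      · subst h'; exact hb.le
      · simp [h0 w h h']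

theorem vertex_coord_self (a : V) : (vertex G a).coord a = 1 := by simp [vertex]

theorem vertex_coord_ne {a w : V} (h : w ≠ a) : (vertex G a).coord w = 0 := by simp [vertex, h]

theorem eq_vertex_or_innerOf (x : Point G) : (∃ a, x = vertex G a) ∨ ∃ a b, x.InnerOf a b := by
  rcases x.mem with ⟨a, h1, h0⟩ | ⟨a, b, hab, ha, hb, hs, h0⟩
  · exact Or.inl ⟨a, eq_vertex h1 h0⟩
  · exact Or.inr ⟨a, b, ⟨hab, hs⟩, ha, hb⟩

theorem OnEdge.symm {x : Point G} {a b : V} (h : x.OnEdge a b) : x.OnEdge b a :=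
  ⟨h.1.symm, by rw [add_comm]; exact h.2⟩

theorem InnerOf.symm {x : Point G} {a b : V} (h : x.InnerOf a b) : x.InnerOf b a :=
  ⟨h.1.symm, h.2.2, h.2.1⟩

theorem OnEdge.coord_eq_zero {x : Point G} {a b w : V} (h : x.OnEdge a b) (ha : w ≠ a)
    (hb : w ≠ b) : x.coord w = 0 := by
  obtain ⟨hab, hs⟩ := h
  have hne := hab.ne
  rcases x.mem with ⟨c, h1, h0⟩ | ⟨c, d, hcd, hc, hd, hs', h0⟩
  · by_cases hw : w = c
    · subst hw
      rw [h0 a ha.symm, h0 b hb.symm] at hs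
      norm_num at hs
    · exact h0 w hw
  · rcases onEdge_inner hc hd hs' h0 ⟨hab, hs⟩ with ⟨rfl, rfl⟩ | ⟨rfl, rfl⟩
    exacts [h0 w ha hb, h0 w hb ha]

theorem onEdge_left {a b : V} (h : G.Adj a b) : (vertex G a).OnEdge a b :=
  ⟨h, by rw [vertex_coord_self, vertex_coord_ne h.ne.symm, add_zero]⟩

theorem onEdge_right {a b : V} (h : G.Adj a b) : (vertex G b).OnEdge a b :=
  (onEdge_left h.symm).symm

theorem innerOf_of_pos {x : Point G} {a b : V} (hab : a ≠ b) (ha : 0 < x.coord a)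
    (hb : 0 < x.coord b) : x.InnerOf a b := by
  rcases x.eq_vertex_or_innerOf with ⟨c, rfl⟩ | ⟨c, d, h⟩
  · have h1 : a = c := by
      by_contra h
      rw [vertex_coord_ne h] at ha
      exact ha.false
    have h2 : b = c := by
      by_contra h
      rw [vertex_coord_ne h] at hb
      exact hb.false
    exact absurd (h1.trans h2.symm) hab
  · have hm : ∀ w, 0 < x.coord w → w = c ∨ w = d := by
      intro w hw
      by_contra! hne
      exact hw.ne' (h.1.coord_eq_zero hne.1 hne.2)
    rcases hm a ha with rfl | rfl <;> rcases hm b hb with rfl | rfl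
    exacts [absurd rfl hab, h, h.symm, absurd rfl hab]

theorem exists_innerOf {a b : V} (hab : G.Adj a b) {c : ℝ} (h0 : 0 < c) (h1 : c < 1) :
    ∃ x : Point G, x.InnerOf a b ∧ x.coord a = c := by
  classical
  let f : V → ℝ := fun w => if w = a then c else if w = b then 1 - c else 0
  have fa : f a = c := by simp [f]
  have fb : f b = 1 - c := by simp [f, hab.ne.symm]
  refine ⟨⟨f, Or.inr ⟨a, b, hab, by rw [fa]; exact h0, by rw [fb]; linarith, by rw [fa, fb]; ring,
    fun w h h' => by simp [f, h, h']⟩⟩, ⟨⟨hab, ?_⟩, ?_, ?_⟩, fa⟩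
  · change f a + f b = 1
    rw [fa, fb]; ring
  · change 0 < f a
    rw [fa]; exact h0
  · change 0 < f b
    rw [fb]; linarith

/-- The sum of the coordinates of `x` in `A`. -/
noncomputable def mass (A : Set V) (x : Point G) : ℝ := ∑ᶠ w, A.indicator x.coord w

theorem mass_vertex (A : Set V) (a : V) : mass A (vertex G a) = A.indicator 1 a := by
  rw [mass, finsum_eq_single _ a]
  · by_cases h : a ∈ A <;> simp [h, vertex_coord_self]
  · intro w hw
    by_cases h : w ∈ A <;> simp [h, vertex_coord_ne hw]

theorem mass_of_onEdge (A : Set V) {x : Point G} {a b : V} (h : x.OnEdge a b) :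
    mass A x = A.indicator x.coord a + A.indicator x.coord b := by
  classical
  rw [mass, finsum_eq_sum_of_support_subset (s := {a, b}), Finset.sum_pair h.1.ne]
  intro w hw
  by_contra hne
  simp only [Finset.coe_insert, Finset.coe_singleton, Set.mem_insert_iff, Set.mem_singleton_iff,
    not_or] at hne
  refine hw ?_
  by_cases hA : w ∈ A <;> simp [hA, h.coord_eq_zero hne.1 hne.2]

theorem mass_singleton (v : V) (x : Point G) : mass {v} x = x.coord v := by
  rw [mass, finsum_eq_single _ v]
  · simp
  · intro w hw
    simp [hw]

theorem mass_univ (x : Point G) : mass Set.univ x = 1 := by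
  rcases x.eq_vertex_or_innerOf with ⟨c, rfl⟩ | ⟨c, d, h⟩
  · simp [mass_vertex]
  · rw [mass_of_onEdge _ h.1]
    simpa using h.1.2

theorem mass_le_one (A : Set V) (x : Point G) : mass A x ≤ 1 := by
  rcases x.eq_vertex_or_innerOf with ⟨c, rfl⟩ | ⟨c, d, h⟩
  · rw [mass_vertex]
    by_cases h : c ∈ A <;> simp [h]
  · rw [mass_of_onEdge _ h.1, ← h.1.2]
    exact add_le_add (Set.indicator_le_self' (fun _ _ => x.coord_nonneg _) _)
      (Set.indicator_le_self' (fun _ _ => x.coord_nonneg _) _)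

theorem coord_le_one (x : Point G) (v : V) : x.coord v ≤ 1 := by
  rw [← mass_singleton]
  exact mass_le_one _ _

end Point

/-! ### Estimates for `d_ℓ` and Lipschitz extension to `|G|_ℓ` -/

section Length

variable (ℓ : G.edgeSet → ℝ)

theorem arcDist_le_segmentLength (x y : Point G) : arcDist ℓ x y ≤ segmentLength ℓ x y := inf_le_left

theorem arcDist_vertex_le {a b : V} (p : G.Walk a b) :
    arcDist ℓ (Point.vertex G a) (Point.vertex G b) ≤ walkLength ℓ p := by
  simpa [segmentLength_self] using arcDist_le_through ℓ (Point.vertex G a) (Point.vertex G b) p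

/-- A function that is Lipschitz on every edge is Lipschitz. -/
theorem ofReal_le_arcDist {φ : Point G → ℝ} {K : ℝ} (hK : 0 ≤ K)
    (h : ∀ (a b : V) (hab : G.Adj a b) (x y : Point G), x.OnEdge a b → y.OnEdge a b →
      K * |φ x - φ y| ≤ |x.coord a - y.coord a| * ℓ ⟨s(a, b), hab⟩) (x y : Point G) :
    ENNReal.ofReal (K * |φ x - φ y|) ≤ arcDist ℓ x y := by
  have htri : ∀ x y z : Point G, ENNReal.ofReal (K * |φ x - φ z|) ≤
      ENNReal.ofReal (K * |φ x - φ y|) + ENNReal.ofReal (K * |φ y - φ z|) := by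
    intro x y z
    rw [← ENNReal.ofReal_add (by positivity) (by positivity), ← mul_add]
    gcongr
    exact abs_sub_le _ _ _
  have hseg : ∀ x y : Point G, ENNReal.ofReal (K * |φ x - φ y|) ≤ segmentLength ℓ x y := by
    intro x y
    by_cases hxy : x = y
    · simp [hxy]
    · rw [segmentLength, if_neg hxy]
      exact le_iInf fun a => le_iInf fun b => le_iInf fun hab => le_iInf fun hx => le_iInf fun hy =>
        ENNReal.ofReal_le_ofReal (h a b hab x y hx hy)
  -- An arc is a segment, a path and a segment, so it suffices to add up the estimates along the
  -- edges of the path.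
  have hwalk : ∀ {a b : V} (p : G.Walk a b),
      ENNReal.ofReal (K * |φ (.vertex G a) - φ (.vertex G b)|) ≤ walkLength ℓ p := by
    intro a b p
    induction p with
    | nil => simp
    | @cons a c b hac p ih =>
      refine (htri _ (.vertex G c) _).trans (add_le_add (ENNReal.ofReal_le_ofReal ?_) ih)
      have := h a c hac _ _ (Point.onEdge_left hac) (Point.onEdge_right hac)
      simpa [Point.vertex_coord_self, Point.vertex_coord_ne hac.ne] using this
  refine le_inf (hseg x y) (le_iInf fun a => le_iInf fun b => le_iInf fun p => ?_)
  exact (htri x (.vertex G b) y).trans (add_le_add ((htri x (.vertex G a) _).trans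
    (add_le_add (hseg _ _) (hwalk _))) (hseg _ _))

/-- The mass is constant on edges with both or neither end in `A`, and equals a single coordinate on
the others. Only the lengths of the edges leaving `A` therefore matter. -/
theorem mass_lipschitz {A : Set V} {K : ℝ} (hK : 0 ≤ K) (hℓ : ∀ e, 0 < ℓ e)
    (h : ∀ (a b : V) (hab : G.Adj a b), a ∈ A → b ∉ A → K ≤ ℓ ⟨s(a, b), hab⟩) (x y : Point G) :
    ENNReal.ofReal (K * |Point.mass A x - Point.mass A y|) ≤ arcDist ℓ x y := by
  refine ofReal_le_arcDist ℓ hK (fun a b hab x y hx hy => ?_) x y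
  rw [Point.mass_of_onEdge A hx, Point.mass_of_onEdge A hy]
  by_cases ha : a ∈ A <;> by_cases hb : b ∈ A <;>
    simp only [ha, hb, Set.indicator_of_mem, Set.indicator_of_notMem, not_false_eq_true,
      add_zero, zero_add]
  · rw [hx.2, hy.2, sub_self, abs_zero, mul_zero]
    exact mul_nonneg (abs_nonneg _) (hℓ _).le
  · rw [mul_comm]
    gcongr
    exact h a b hab ha hb
  · have e1 : x.coord b - y.coord b = -(x.coord a - y.coord a) := by linarith [hx.2, hy.2]
    rw [mul_comm, e1, abs_neg]
    gcongr
    have := h b a hab.symm hb ha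
    rwa [show (⟨s(b, a), hab.symm⟩ : G.edgeSet) = ⟨s(a, b), hab⟩ from Subtype.ext Sym2.eq_swap]
      at this
  · rw [sub_self, abs_zero, mul_zero]
    exact mul_nonneg (abs_nonneg _) (hℓ _).le

/-- This function is positive exactly inside the edge `ab`. It serves to confine a Cauchy sequence
that stays away from the vertices to one edge. -/
theorem min_coord_lipschitz {a b : V} (hab : G.Adj a b) {K : ℝ} (hK : 0 ≤ K) (hℓ : ∀ e, 0 < ℓ e)
    (h : K ≤ ℓ ⟨s(a, b), hab⟩) (x y : Point G) :
    ENNReal.ofReal (K * |min (x.coord a) (x.coord b) - min (y.coord a) (y.coord b)|) ≤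
      arcDist ℓ x y := by
  refine ofReal_le_arcDist (φ := fun x => min (x.coord a) (x.coord b)) ℓ hK
    (fun c d hcd x y hx hy => ?_) x y
  have hpos : 0 ≤ |x.coord c - y.coord c| * ℓ ⟨s(c, d), hcd⟩ :=
    mul_nonneg (abs_nonneg _) (hℓ _).le
  have key : |min (x.coord c) (x.coord d) - min (y.coord c) (y.coord d)| ≤
      |x.coord c - y.coord c| := by
    refine (abs_min_sub_min_le_max _ _ _ _).trans (max_le le_rfl (le_of_eq ?_))
    rw [show x.coord d - y.coord d = -(x.coord c - y.coord c) by linarith [hx.2, hy.2], abs_neg]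
  have hzero : ∀ w, w ≠ c → w ≠ d → x.coord w = 0 ∧ y.coord w = 0 :=
    fun w h h' => ⟨hx.coord_eq_zero h h', hy.coord_eq_zero h h'⟩
  change K * |min (x.coord a) (x.coord b) - min (y.coord a) (y.coord b)| ≤ _
  by_cases ha : a = c ∨ a = d
  · by_cases hb : b = c ∨ b = d
    · have hne := hab.ne
      rcases ha with rfl | rfl <;> rcases hb with rfl | rfl
      · exact absurd rfl hne
      · rw [mul_comm]; gcongr
      · rw [mul_comm, min_comm (x.coord a), min_comm (y.coord a)]
        gcongr
        rwa [show (⟨s(b, a), hcd⟩ : G.edgeSet) = ⟨s(a, b), hab⟩ from Subtype.ext Sym2.eq_swap]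
      · exact absurd rfl hne
    · push Not at hb
      rw [(hzero b hb.1 hb.2).1, (hzero b hb.1 hb.2).2, min_eq_right (x.coord_nonneg a),
        min_eq_right (y.coord_nonneg a)]
      simpa using hpos
  · push Not at ha
    rw [(hzero a ha.1 ha.2).1, (hzero a ha.1 ha.2).2, min_eq_left (x.coord_nonneg b),
      min_eq_left (y.coord_nonneg b)]
    simpa using hpos

theorem arcDist_onEdge_le {x y : Point G} {a b : V} (hx : x.OnEdge a b) (hy : y.OnEdge a b)
    {K : ℝ} (hK : ℓ ⟨s(a, b), hx.1⟩ ≤ K) :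
    arcDist ℓ x y ≤ ENNReal.ofReal (|x.coord a - y.coord a| * K) :=
  (arcDist_le_segmentLength ℓ x y).trans ((segmentLength_le ℓ hx.1 hx hy).trans (by gcongr))

theorem arcDist_vertex_le_of_pos (hℓ1 : ∀ e, ℓ e ≤ 1) {x : Point G} {v : V}
    (h : 0 < x.coord v) : arcDist ℓ x (.vertex G v) ≤ ENNReal.ofReal (1 - x.coord v) := by
  have key : ∀ {c d : V}, x.InnerOf c d →
      arcDist ℓ x (.vertex G c) ≤ ENNReal.ofReal (1 - x.coord c) := by
    intro c d hcd
    refine (arcDist_onEdge_le ℓ hcd.1 (Point.onEdge_left hcd.1.1) (hℓ1 _)).trans (le_of_eq ?_)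
    rw [Point.vertex_coord_self, mul_one, abs_sub_comm, abs_of_nonneg]
    linarith [x.coord_le_one c]
  rcases x.eq_vertex_or_innerOf with ⟨c, rfl⟩ | ⟨c, d, hcd⟩
  · have h1 : v = c := by
      by_contra hne
      rw [Point.vertex_coord_ne hne] at h
      exact h.false
    subst h1
    rw [arcDist_self]
    exact zero_le
  · by_cases h1 : v = c
    · subst h1; exact key hcd
    by_cases h2 : v = d
    · subst h2; exact key hcd.symm
    rw [hcd.1.coord_eq_zero h1 h2] at h
    exact absurd h (lt_irrefl _)

theorem arcDist_ne_top (hG : G.Connected) (x y : Point G) :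
    arcDist ℓ x y ≠ ⊤ := by
  have hwalk : ∀ {a b : V} (p : G.Walk a b), walkLength ℓ p ≠ ⊤ := by
    intro a b p
    induction p with
    | nil => simp [walkLength]
    | cons h p ih => simp [walkLength, ih]
  have hv : ∀ x : Point G, ∃ a, arcDist ℓ x (.vertex G a) ≠ ⊤ := by
    intro x
    rcases x.eq_vertex_or_innerOf with ⟨c, rfl⟩ | ⟨c, d, hcd⟩
    · exact ⟨c, by simp [arcDist_self]⟩
    · exact ⟨c, ne_top_of_le_ne_top ENNReal.ofReal_ne_top
        (arcDist_onEdge_le ℓ hcd.1 (Point.onEdge_left hcd.1.1) le_rfl)⟩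
  obtain ⟨a, ha⟩ := hv x
  obtain ⟨b, hb⟩ := hv y
  obtain ⟨p⟩ := hG.preconnected a b
  have h1 := ne_top_of_le_ne_top (hwalk p) (arcDist_vertex_le ℓ p)
  refine ne_top_of_le_ne_top (ENNReal.add_ne_top.2 ⟨ENNReal.add_ne_top.2 ⟨ha, h1⟩, hb⟩)
    ((arcDist_triangle ℓ x (.vertex G b) y).trans ?_)
  rw [arcDist_comm ℓ (.vertex G b) y]
  gcongr
  exact arcDist_triangle _ _ _ _

/-- `|G|_ℓ` as a metric space. -/
@[reducible] noncomputable def LTop.metricSpace (hG : G.Connected) :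
    MetricSpace (LTop ℓ) :=
  letI : PseudoMetricSpace (LengthSpace ℓ) :=
    PseudoEMetricSpace.toPseudoMetricSpace (arcDist_ne_top ℓ hG)
  UniformSpace.Completion.instMetricSpace

theorem LTop.dist_ofPoint (hG : G.Connected) (x y : Point G) :
    letI := LTop.metricSpace ℓ hG
    dist (LTop.ofPoint ℓ x) (LTop.ofPoint ℓ y) = (arcDist ℓ x y).toReal := by
  let m : PseudoMetricSpace (LengthSpace ℓ) :=
    PseudoEMetricSpace.toPseudoMetricSpace (arcDist_ne_top ℓ hG)
  exact UniformSpace.Completion.dist_eq _ _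

theorem LTop.denseRange_ofPoint : DenseRange (LTop.ofPoint ℓ) :=
  UniformSpace.Completion.denseRange_coe.comp
    (SeparationQuotient.surjective_mk (X := LengthSpace ℓ)).denseRange
    (UniformSpace.Completion.continuous_coe _)

theorem LTop.metrizable (hG : G.Connected) :
    TopologicalSpace.MetrizableSpace (LTop ℓ) := by
  let _ := LTop.metricSpace ℓ hG
  infer_instance

/-- Lipschitz functions extend to `|G|_ℓ`. -/
theorem LTop.exists_extension (hG : G.Connected) {φ : Point G → ℝ} {K : ℝ}
    (hK : 0 < K) (h : ∀ x y, ENNReal.ofReal (K * |φ x - φ y|) ≤ arcDist ℓ x y) :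
    ∃ Φ : LTop ℓ → ℝ, Continuous Φ ∧ ∀ x, Φ (LTop.ofPoint ℓ x) = φ x := by
  let m : PseudoMetricSpace (LengthSpace ℓ) :=
    PseudoEMetricSpace.toPseudoMetricSpace (arcDist_ne_top ℓ hG)
  have hu : UniformContinuous (fun x : LengthSpace ℓ => φ x) := by
    have : LipschitzWith (Real.toNNReal K⁻¹) (fun x : LengthSpace ℓ => φ x) := by
      refine LipschitzWith.of_dist_le_mul fun x y => ?_
      rw [Real.coe_toNNReal _ (by positivity), Real.dist_eq]
      have h1 := (ENNReal.ofReal_le_iff_le_toReal (arcDist_ne_top ℓ hG x y)).1 (h x y)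
      calc |φ x - φ y| = K⁻¹ * (K * |φ x - φ y|) := by field_simp
        _ ≤ K⁻¹ * dist x y := by
          refine mul_le_mul_of_nonneg_left h1 (by positivity)
    exact this.uniformContinuous
  refine ⟨UniformSpace.Completion.extension (SeparationQuotient.lift' fun x : LengthSpace ℓ => φ x),
    UniformSpace.Completion.continuous_extension, fun x => ?_⟩
  exact (UniformSpace.Completion.extension_coe (SeparationQuotient.uniformContinuous_lift' _) _).trans
    (SeparationQuotient.lift'_mk hu x)

end Length

/-! ### Comparison of masses -/

namespace Point

theorem finite_support (x : Point G) : (Function.support x.coord).Finite := by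
  rcases x.eq_vertex_or_innerOf with ⟨c, rfl⟩ | ⟨c, d, h⟩
  · refine (Set.finite_singleton c).subset fun w hw => ?_
    by_contra hne
    exact hw (vertex_coord_ne hne)
  · refine (Set.toFinite {c, d}).subset fun w hw => ?_
    by_contra hne
    simp only [Set.mem_insert_iff, Set.mem_singleton_iff, not_or] at hne
    exact hw (h.1.coord_eq_zero hne.1 hne.2)

theorem finite_support_indicator (A : Set V) (x : Point G) :
    (Function.support (A.indicator x.coord)).Finite :=
  x.finite_support.subset (by rw [Set.support_indicator]; exact Set.inter_subset_right)

theorem mass_mono {A B : Set V} {x : Point G} (h : ∀ w ∈ A, 0 < x.coord w → w ∈ B) :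
    mass A x ≤ mass B x := by
  refine finsum_le_finsum' (x.finite_support_indicator A) (x.finite_support_indicator B) fun w => ?_
  by_cases hA : w ∈ A
  · rcases (x.coord_nonneg w).eq_or_lt with h0 | h0
    · rw [Set.indicator_of_mem hA, ← h0]
      exact Set.indicator_nonneg (fun w _ => x.coord_nonneg w) w
    · rw [Set.indicator_of_mem hA, Set.indicator_of_mem (h w hA h0)]
  · rw [Set.indicator_of_notMem hA]
    exact Set.indicator_nonneg (fun w _ => x.coord_nonneg w) w

theorem coord_le_mass {A : Set V} {a : V} (ha : a ∈ A) (x : Point G) : x.coord a ≤ mass A x := by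
  rw [← mass_singleton]
  exact mass_mono fun w hw _ => by rwa [Set.mem_singleton_iff.1 hw]

theorem mass_eq_one {A : Set V} {x : Point G} (h : ∀ w, x.coord w ≠ 0 → w ∈ A) : mass A x = 1 :=
  le_antisymm (mass_le_one A x) (by
    rw [← mass_univ x]
    exact mass_mono fun w _ hw => h w hw.ne')

theorem exists_of_mass_pos {A : Set V} {x : Point G} (h : 0 < mass A x) :
    ∃ a ∈ A, 0 < x.coord a := by
  by_contra! hcon
  have : mass A x ≤ mass ∅ x := mass_mono fun w hw h' => absurd h' (hcon w hw).not_gt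
  rw [mass, mass] at this
  simp only [Set.indicator_empty, finsum_zero] at this
  exact this.not_gt h

theorem mass_eq_add {A : Set V} {a : V} (ha : a ∈ A) (x : Point G) :
    mass A x = x.coord a + mass (A \ {a}) x := by
  rw [← mass_singleton, mass, mass, mass, ← finsum_add_distrib (x.finite_support_indicator _)
    (x.finite_support_indicator _)]
  refine finsum_congr fun w => ?_
  by_cases hw : w = a
  · subst hw; simp [ha]
  · by_cases hA : w ∈ A <;> simp [hw, hA]

end Point

/-! ### The tree order and the points of `G` -/

namespace NormalTree

variable (T : NormalTree G)

/-- The vertices above `t` in the tree order. -/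
def up (t : V) : Set V := {w | T.le t w}

theorem lev_le {a b : V} (h : T.le a b) : T.lev a ≤ T.lev b := by
  by_cases hab : a = b
  · rw [hab]
  · exact (T.lev_lt h hab).le

theorem eq_of_le_of_lev_le {a b : V} (h : T.le a b) (hl : T.lev b ≤ T.lev a) : a = b := by
  by_contra hab
  exact (T.lev_lt h hab).not_ge hl

theorem antisymm {a b : V} (h : T.le a b) (h' : T.le b a) : a = b :=
  T.eq_of_le_of_lev_le h (T.lev_le h')

theorem le_of_lev_le {a b c : V} (ha : T.le a c) (hb : T.le b c) (h : T.lev a ≤ T.lev b) :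
    T.le a b := by
  rcases T.chain ha hb with h' | h'
  · exact h'
  · rw [T.eq_of_le_of_lev_le h' h]; exact T.refl a

theorem eq_of_lev_eq {a b c : V} (ha : T.le a c) (hb : T.le b c) (h : T.lev a = T.lev b) : a = b :=
  T.antisymm (T.le_of_lev_le ha hb h.le) (T.le_of_lev_le hb ha h.ge)

/-- Two vertices at which `x` has positive coordinates are equal or adjacent, hence comparable; the
larger one serves as the common upper bound. -/
theorem exists_le_of_mass_pos {t t' : V} {x : Point G} (h : 0 < Point.mass (T.up t) x)
    (h' : 0 < Point.mass (T.up t') x) : ∃ c, T.le t c ∧ T.le t' c := by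
  obtain ⟨a, ha, hxa⟩ := Point.exists_of_mass_pos h
  obtain ⟨b, hb, hxb⟩ := Point.exists_of_mass_pos h'
  by_cases hab : a = b
  · exact ⟨a, ha, hab ▸ hb⟩
  · rcases T.adj_comp (Point.innerOf_of_pos hab hxa hxb).1.1 with h | h
    · exact ⟨b, T.trans ha h, hb⟩
    · exact ⟨a, ha, T.trans hb h⟩

/-- By comparability, an edge with both ends strictly above `t` lies above a single child of `t`, so
the mass above `t` is not split between children. -/
theorem exists_child_mass {t : V} {x : Point G} (h : x.coord t < Point.mass (T.up t) x) :
    ∃ c, T.lev c = T.lev t + 1 ∧ Point.mass (T.up t) x ≤ x.coord t + Point.mass (T.up c) x := by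
  rw [Point.mass_eq_add (show t ∈ T.up t from T.refl t)] at h ⊢
  obtain ⟨a, ⟨ha, hat⟩, hxa⟩ := Point.exists_of_mass_pos (pos_of_lt_add_right h)
  obtain ⟨c, -, hc, htc, hca⟩ := T.exists_child ha (Ne.symm hat)
  refine ⟨c, hc, add_le_add le_rfl (Point.mass_mono ?_)⟩
  rintro w ⟨hw, hwt⟩ hxw
  by_cases hwa : w = a
  · rw [hwa]; exact hca
  rcases T.adj_comp (Point.innerOf_of_pos hwa hxw hxa).1.1 with h | h
  · refine T.le_of_lev_le hca h ?_
    have := T.lev_lt hw (Ne.symm hwt)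
    omega
  · exact T.trans hca h

/-! ### The edge lengths -/

/-- The height `2⁻ⁿ` of a vertex of level `n`. -/
noncomputable def ht (v : V) : ℝ := (1 / 2) ^ T.lev v

/-- The length of an edge is the difference of the heights of its ends. -/
noncomputable def len (e : G.edgeSet) : ℝ :=
  Sym2.lift ⟨fun a b => |T.ht a - T.ht b|, fun _ _ => abs_sub_comm _ _⟩ e.1

theorem len_mk {a b : V} (h : G.Adj a b) : T.len ⟨s(a, b), h⟩ = |T.ht a - T.ht b| := rfl

theorem len_mk_symm {a b : V} (h : G.Adj a b) : T.len ⟨s(a, b), h⟩ = T.len ⟨s(b, a), h.symm⟩ :=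
  abs_sub_comm _ _

theorem ht_pos (v : V) : 0 < T.ht v := by unfold ht; positivity

theorem ht_le_one (v : V) : T.ht v ≤ 1 := pow_le_one₀ (by norm_num) (by norm_num)

theorem ht_anti {a b : V} (h : T.le a b) : T.ht b ≤ T.ht a :=
  pow_le_pow_of_le_one (by norm_num) (by norm_num) (T.lev_le h)

theorem ht_le_half {a b : V} (h : T.le a b) (hab : a ≠ b) : T.ht b ≤ T.ht a / 2 := by
  calc T.ht b ≤ (1 / 2) ^ (T.lev a + 1) :=
        pow_le_pow_of_le_one (by norm_num) (by norm_num) (T.lev_lt h hab)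
    _ = T.ht a / 2 := by rw [pow_succ, ht]; ring

theorem len_of_le {a b : V} (h : G.Adj a b) (hab : T.le a b) :
    T.len ⟨s(a, b), h⟩ = T.ht a - T.ht b := by
  rw [len_mk, abs_of_nonneg (sub_nonneg.2 (T.ht_anti hab))]

/-- Heights at least halve going up, so an edge is at least half as long as the height of its lower
end, and at least as long as the height of its upper end. -/
theorem half_ht_le_len {a b : V} (h : G.Adj a b) : T.ht a / 2 ≤ T.len ⟨s(a, b), h⟩ := by
  have := T.ht_pos a
  rcases T.adj_comp h with hab | hab
  · rw [T.len_of_le h hab]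
    linarith [T.ht_le_half hab h.ne]
  · rw [T.len_mk_symm h, T.len_of_le h.symm hab]
    linarith [T.ht_le_half hab h.ne.symm]

theorem len_pos (e : G.edgeSet) : 0 < T.len e := by
  obtain ⟨e, he⟩ := e
  induction e using Sym2.inductionOn with
  | _ a b =>
    have := T.ht_pos a
    exact lt_of_lt_of_le (by positivity) (T.half_ht_le_len he)

theorem len_le_of_up {a b t : V} (h : G.Adj a b) (ha : a ∈ T.up t) (hb : b ∈ T.up t) :
    T.len ⟨s(a, b), h⟩ ≤ T.ht t := by
  rw [len_mk, abs_le]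
  have h1 := T.ht_anti ha
  have h2 := T.ht_anti hb
  have h3 := T.ht_pos a
  have h4 := T.ht_pos b
  constructor <;> linarith

theorem len_le_one (e : G.edgeSet) : T.len e ≤ 1 := by
  obtain ⟨e, he⟩ := e
  induction e using Sym2.inductionOn with
  | _ a b => exact (T.len_le_of_up he (T.root_le a) (T.root_le b)).trans (T.ht_le_one _)

theorem le_of_adj_of_notMem_up {a b t : V} (h : G.Adj a b) (ha : a ∈ T.up t) (hb : b ∉ T.up t) :
    T.le b t ∧ b ≠ t := by
  have hba : T.le b a := (T.adj_comp h).resolve_left fun h' => hb (T.trans ha h')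
  refine ⟨(T.chain ha hba).resolve_left hb, ?_⟩
  rintro rfl
  exact hb (T.refl b)

/-- The end `b` lies strictly below `t`, so its height is at least twice that of `t`, while that of
`a` is at most that of `t`. -/
theorem ht_le_len {a b t : V} (h : G.Adj a b) (ha : a ∈ T.up t) (hb : b ∉ T.up t) :
    T.ht t ≤ T.len ⟨s(a, b), h⟩ := by
  obtain ⟨hbt, hne⟩ := T.le_of_adj_of_notMem_up h ha hb
  rw [T.len_mk_symm h, T.len_of_le h.symm (T.trans hbt ha)]
  linarith [T.ht_le_half hbt hne, T.ht_anti ha]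

/-- Climb the tree from child to child: the differences of heights telescope. -/
theorem exists_walk {a b : V} (hab : T.le a b) : ∃ p : G.Walk a b, (∀ x ∈ p.support, x ∈ T.up a) ∧
    walkLength T.len p ≤ ENNReal.ofReal (T.ht a - T.ht b) := by
  by_cases h : a = b
  · subst h
    exact ⟨.nil, by simp [up, T.refl], by simp [walkLength]⟩
  obtain ⟨c, hac, hc, hac', hcb⟩ := T.exists_child hab h
  have := T.lev_lt hab h
  obtain ⟨p, hp, hl⟩ := exists_walk hcb
  refine ⟨.cons hac p, ?_, ?_⟩
  · simp only [SimpleGraph.Walk.support_cons, List.mem_cons, forall_eq_or_imp]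
    exact ⟨T.refl a, fun x hx => T.trans hac' (hp x hx)⟩
  · rw [walkLength, T.len_of_le hac hac']
    refine (add_le_add le_rfl hl).trans (le_of_eq ?_)
    rw [← ENNReal.ofReal_add (sub_nonneg.2 (T.ht_anti hac')) (sub_nonneg.2 (T.ht_anti hcb))]
    congr 1
    ring
termination_by T.lev b - T.lev a

theorem linked_up {t a b : V} (ha : a ∈ T.up t) (hb : b ∈ T.up t) : Linked G (T.up t) a b := by
  obtain ⟨p, hp, -⟩ := T.exists_walk ha
  obtain ⟨q, hq, -⟩ := T.exists_walk hb
  exact Linked.trans (Linked.symm ⟨p, hp⟩) ⟨q, hq⟩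

theorem arcDist_up_le {t a : V} (ha : a ∈ T.up t) :
    arcDist T.len (.vertex G a) (.vertex G t) ≤ ENNReal.ofReal (T.ht t) := by
  obtain ⟨p, -, hp⟩ := T.exists_walk ha
  rw [arcDist_comm]
  refine (arcDist_vertex_le _ p).trans (hp.trans (ENNReal.ofReal_le_ofReal ?_))
  linarith [T.ht_pos a]

/-- Up-sets are small: a vertex above `t` is within `ht t` of `t`. A point on an edge inside the
up-set costs one more `ht t`. On an edge leaving the up-set, the distance to the upper end is at
most the missing mass, because edges have length at most 1. -/
theorem arcDist_mass_le {t : V} {x : Point G} (h : 0 < Point.mass (T.up t) x) :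
    arcDist T.len x (.vertex G t) ≤
      ENNReal.ofReal (1 - Point.mass (T.up t) x + 2 * T.ht t) := by
  have hm := Point.mass_le_one (T.up t) x
  have ht := T.ht_pos t
  obtain ⟨a, ha, hxa⟩ := Point.exists_of_mass_pos h
  suffices hs : arcDist T.len x (.vertex G a) ≤
      ENNReal.ofReal (1 - Point.mass (T.up t) x + T.ht t) by
    refine (arcDist_triangle _ x (.vertex G a) _).trans ((add_le_add hs (T.arcDist_up_le ha)).trans
      (le_of_eq ?_))
    rw [← ENNReal.ofReal_add (by linarith) ht.le]
    congr 1
    ring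
  rcases x.eq_vertex_or_innerOf with ⟨c, rfl⟩ | ⟨c, d, hcd⟩
  · have : a = c := by
      by_contra hne
      rw [Point.vertex_coord_ne hne] at hxa
      exact hxa.false
    subst this
    rw [arcDist_self]
    exact zero_le
  · obtain ⟨b, hb⟩ : ∃ b, x.InnerOf a b := by
      by_cases h1 : a = c
      · exact ⟨d, h1 ▸ hcd⟩
      by_cases h2 : a = d
      · exact ⟨c, h2 ▸ hcd.symm⟩
      rw [hcd.1.coord_eq_zero h1 h2] at hxa
      exact absurd hxa (lt_irrefl _)
    by_cases hbt : b ∈ T.up t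
    · refine (arcDist_onEdge_le _ hb.1 (Point.onEdge_left hb.1.1)
        (T.len_le_of_up hb.1.1 ha hbt)).trans (ENNReal.ofReal_le_ofReal ?_)
      have h1 : |x.coord a - (Point.vertex G a).coord a| ≤ 1 := by
        rw [Point.vertex_coord_self, abs_le]
        constructor <;> linarith [x.coord_le_one a]
      nlinarith
    · refine (arcDist_vertex_le_of_pos _ T.len_le_one hxa).trans (ENNReal.ofReal_le_ofReal ?_)
      rw [Point.mass_of_onEdge _ hb.1, Set.indicator_of_mem ha, Set.indicator_of_notMem hbt]
      linarith

theorem mass_up_lipschitz (t : V) (x y : Point G) :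
    ENNReal.ofReal (T.ht t * |Point.mass (T.up t) x - Point.mass (T.up t) y|) ≤
      arcDist T.len x y :=
  mass_lipschitz _ (T.ht_pos t).le T.len_pos (fun _ _ h ha hb => T.ht_le_len h ha hb) x y

theorem coord_lipschitz (v : V) (x y : Point G) :
    ENNReal.ofReal (T.ht v / 2 * |x.coord v - y.coord v|) ≤ arcDist T.len x y := by
  have := T.ht_pos v
  rw [← Point.mass_singleton, ← Point.mass_singleton]
  refine mass_lipschitz _ (by positivity) T.len_pos (fun a b h ha _ => ?_) x y
  obtain rfl := Set.mem_singleton_iff.1 ha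
  exact T.half_ht_le_len h

/-! ### Ends and branches -/

theorem finite_below (t : V) : {a | T.le a t ∧ a ≠ t}.Finite := by
  refine Set.Finite.of_finite_image ((Set.finite_Iio (T.lev t)).subset ?_) (f := T.lev) ?_
  · rintro _ ⟨a, ha, rfl⟩
    exact T.lev_lt ha.1 ha.2
  · intro a ha b hb h
    exact T.eq_of_lev_eq ha.1 hb.1 h

/-- The vertices strictly below `t` in the tree order. -/
noncomputable def below (t : V) : Finset V := (T.finite_below t).toFinset

theorem mem_below {a t : V} : a ∈ T.below t ↔ T.le a t ∧ a ≠ t := by simp [below]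

theorem up_subset_compl_below (t : V) : T.up t ⊆ (T.below t : Set V)ᶜ := by
  intro a ha h
  obtain ⟨h1, h2⟩ := T.mem_below.1 h
  exact h2 (T.antisymm h1 ha)

/-- Edges leaving the up-set of `t` end strictly below `t`. Since the up-set is also linked, it is a
component of `G` minus the finite set `T.below t`. -/
theorem mem_up_of_linked {t a b : V} (ha : a ∈ T.up t)
    (h : Linked G (T.below t : Set V)ᶜ a b) : b ∈ T.up t := by
  obtain ⟨p, hp⟩ := h
  induction p with
  | nil => exact ha
  | cons h p ih =>
    simp only [SimpleGraph.Walk.support_cons, List.mem_cons, forall_eq_or_imp] at hp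
    refine ih ?_ hp.2
    by_contra hb
    exact hp.2 _ p.start_mem_support (T.mem_below.2 (T.le_of_adj_of_notMem_up h ha hb))

theorem endComponent_below {R : Ray G} {t : V} (h : R.HasTailIn (T.up t)) :
    endComponent (T.below t) (Quotient.mk _ R) = T.up t := by
  obtain ⟨C, hC, -⟩ := exists_endComponent_eq (T.below t) (Quotient.mk _ R)
  obtain ⟨N, hN⟩ := hasTailIn_endComponent (T.below t) R
  obtain ⟨M, hM⟩ := h
  have h1 := hN (max M N) (le_max_right _ _)
  have h2 := hM (max M N) (le_max_left _ _)
  refine Set.Subset.antisymm (fun v hv => ?_) fun v hv =>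
    mem_endComponent_of_linked h1 ((T.linked_up h2 hv).mono (T.up_subset_compl_below t))
  rw [hC] at h1 hv
  exact T.mem_up_of_linked h2 (Linked.of_mem_component h1 hv)

theorem hasTailIn_up_congr {R L : Ray G} (hRL : Quotient.mk (raySetoid G) R = Quotient.mk _ L)
    {t : V} (h : R.HasTailIn (T.up t)) : L.HasTailIn (T.up t) := by
  rw [← T.endComponent_below h, hRL]
  exact hasTailIn_endComponent _ L

theorem exists_hasTailIn_up (R : Ray G) (n : ℕ) : ∃ t, T.lev t = n ∧ R.HasTailIn (T.up t) := by
  induction n with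
  | zero => exact ⟨T.root, T.lev_root, 0, fun n _ => T.root_le _⟩
  | succ n ih =>
    obtain ⟨t, rfl, N, hN⟩ := ih
    -- A ray visits `t` at most once, so a tail of it lies strictly above `t`.
    obtain ⟨M, hM, hMt⟩ : ∃ M, N ≤ M ∧ ∀ n, M ≤ n → R.vert n ≠ t := by
      by_cases h : ∃ m, R.vert m = t
      · obtain ⟨m, hm⟩ := h
        refine ⟨max N (m + 1), le_max_left _ _, fun n hn hnt => ?_⟩
        have := R.injective (hm.trans hnt.symm)
        omega
      · push Not at h
        exact ⟨N, le_rfl, fun n _ => h n⟩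
    obtain ⟨c, -, hc, htc, hcM⟩ := T.exists_child (hN M hM) (hMt M le_rfl).symm
    refine ⟨c, hc, M, fun n hn => ?_⟩
    induction n, hn using Nat.le_induction with
    | base => exact hcM
    | succ n hn ih =>
      -- Consecutive vertices of the tail are comparable and strictly above `t`, so they lie above
      -- the same child.
      rcases T.adj_comp (R.adj n) with h | h
      · exact T.trans ih h
      · refine T.le_of_lev_le ih h ?_
        have := T.lev_lt (hN (n + 1) (by omega)) (hMt (n + 1) (by omega)).symm
        omega

/-- The vertex of level `n` whose up-set contains tails of the rays of `ω`. -/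
noncomputable def branch (ω : VertexEnd G) (n : ℕ) : V :=
  (T.exists_hasTailIn_up (Quotient.out ω) n).choose

theorem lev_branch (ω : VertexEnd G) (n : ℕ) : T.lev (T.branch ω n) = n :=
  (T.exists_hasTailIn_up (Quotient.out ω) n).choose_spec.1

theorem hasTailIn_branch (R : Ray G) (n : ℕ) :
    R.HasTailIn (T.up (T.branch (Quotient.mk _ R) n)) :=
  T.hasTailIn_up_congr (Quotient.out_eq _)
    (T.exists_hasTailIn_up (Quotient.out (Quotient.mk (raySetoid G) R)) n).choose_spec.2

theorem le_of_hasTailIn {R : Ray G} {s t : V} (hs : R.HasTailIn (T.up s))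
    (ht : R.HasTailIn (T.up t)) (h : T.lev s ≤ T.lev t) : T.le s t := by
  obtain ⟨N, hN⟩ := hs
  obtain ⟨M, hM⟩ := ht
  exact T.le_of_lev_le (hN (max N M) (le_max_left _ _)) (hM (max N M) (le_max_right _ _)) h

theorem branch_mk_eq_iff {R : Ray G} {t : V} :
    T.branch (Quotient.mk _ R) (T.lev t) = t ↔ R.HasTailIn (T.up t) := by
  have h := T.hasTailIn_branch R (T.lev t)
  refine ⟨fun e => e ▸ h, fun h' => ?_⟩
  exact T.eq_of_le_of_lev_le (T.le_of_hasTailIn h h' (T.lev_branch _ _).le)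
    (T.lev_branch _ _).ge

theorem branch_le (ω : VertexEnd G) {m n : ℕ} (h : m ≤ n) :
    T.le (T.branch ω m) (T.branch ω n) := by
  induction ω using Quotient.inductionOn with
  | _ R =>
    exact T.le_of_hasTailIn (T.hasTailIn_branch R m) (T.hasTailIn_branch R n)
      ((T.lev_branch _ _).le.trans (h.trans (T.lev_branch _ _).ge))

theorem adj_of_lev {a b : V} (h : T.le a b) (hl : T.lev b = T.lev a + 1) : G.Adj a b := by
  obtain ⟨c, hac, hc, -, hcb⟩ := T.exists_child h (by rintro rfl; omega)
  rwa [← T.eq_of_le_of_lev_le hcb (by omega)]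

/-- An infinite branch of the tree, as a ray. -/
def rayOfBranch (t : ℕ → V) (hl : ∀ n, T.lev (t n) = n) (hle : ∀ n, T.le (t n) (t (n + 1))) :
    Ray G where
  vert := t
  injective m n h := by rw [← hl m, ← hl n, h]
  adj n := T.adj_of_lev (hle n) (by rw [hl, hl])

theorem branch_rayOfBranch (t : ℕ → V) (hl : ∀ n, T.lev (t n) = n)
    (hle : ∀ n, T.le (t n) (t (n + 1))) (n : ℕ) :
    T.branch (Quotient.mk _ (T.rayOfBranch t hl hle)) n = t n := by
  have : (T.rayOfBranch t hl hle).HasTailIn (T.up (t n)) := by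
    refine ⟨n, fun m hm => ?_⟩
    induction m, hm using Nat.le_induction with
    | base => exact T.refl _
    | succ m hm ih => exact T.trans ih (hle m)
  rw [← T.branch_mk_eq_iff, hl] at this
  exact this

/-- Beyond the highest level of a vertex in `S`, no vertex of an up-set can lie in `S`. -/
theorem exists_disjoint_branch (S : Finset V) (ω : VertexEnd G) :
    ∃ n, T.up (T.branch ω n) ⊆ (S : Set V)ᶜ := by
  refine ⟨S.sup T.lev + 1, fun v hv hS => ?_⟩
  have h1 := T.lev_le hv
  have h2 : T.lev v ≤ S.sup T.lev := Finset.le_sup hS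
  rw [T.lev_branch] at h1
  omega

theorem up_branch_subset {S : Finset V} {ω : VertexEnd G} {n : ℕ}
    (h : T.up (T.branch ω n) ⊆ (S : Set V)ᶜ) : T.up (T.branch ω n) ⊆ endComponent S ω := by
  intro v hv
  induction ω using Quotient.inductionOn with
  | _ R =>
    obtain ⟨N, hN⟩ := T.hasTailIn_branch R n
    obtain ⟨M, hM⟩ := hasTailIn_endComponent S R
    exact mem_endComponent_of_linked (hM (max N M) (le_max_right _ _))
      ((T.linked_up (hN _ (le_max_left _ _)) hv).mono h)

/-- An end is determined by its branch. -/
theorem branch_injective : Function.Injective T.branch := by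
  intro ω ω' h
  induction ω using Quotient.inductionOn with
  | _ R =>
    induction ω' using Quotient.inductionOn with
    | _ L =>
      refine Quotient.sound fun S => ?_
      obtain ⟨C, hC, -⟩ := exists_endComponent_eq S (Quotient.mk _ R)
      obtain ⟨n, hn⟩ := T.exists_disjoint_branch S (Quotient.mk _ R)
      have hsub := T.up_branch_subset hn
      rw [hC] at hsub
      refine ⟨C, (T.hasTailIn_branch R n).mono hsub, ?_⟩
      rw [h] at hsub
      exact (T.hasTailIn_branch L n).mono hsub

theorem endComponent_branch (ω : VertexEnd G) (n : ℕ) :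
    endComponent (T.below (T.branch ω n)) ω = T.up (T.branch ω n) := by
  induction ω using Quotient.inductionOn with
  | _ R => exact T.endComponent_below (T.hasTailIn_branch R n)

theorem hasRayIn_of_branch_eq {ω : VertexEnd G} {t : V} (h : T.branch ω (T.lev t) = t) :
    ω.HasRayIn (T.up t) := by
  induction ω using Quotient.inductionOn with
  | _ R => exact (T.branch_mk_eq_iff.1 h).hasRayIn

theorem branch_eq_of_hasRayIn {ω : VertexEnd G} {t : V} (h : ω.HasRayIn (T.up t)) :
    T.branch ω (T.lev t) = t := by
  obtain ⟨R, rfl, hR⟩ := h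
  exact T.branch_mk_eq_iff.2 ⟨0, fun n _ => hR n⟩

end NormalTree

/-! ### Generating sets of `MTOP(G)` and sequences in `|G|_ℓ` -/

open Filter Topology

/-- The function on `MTOP(G)` given by `f` on the points of `G` and by `e` on the ends. -/
def MTop.elim {X : Type u} (f : Point G → X) (e : VertexEnd G → X) : MTop G → X
  | .point x => f x
  | .vertexEnd ω => e ω

theorem MTop.isOpen_edgePart (a b : V) {U : Set ℝ} (hU : IsOpen U) :
    IsOpen (MTop.edgePart G a b U) :=
  TopologicalSpace.isOpen_generateFrom_of_mem (Or.inl (Or.inl ⟨a, b, U, hU, rfl⟩))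

theorem MTop.isOpen_openStar (v : V) {ε : ℝ} (h0 : 0 < ε) (h1 : ε < 1) :
    IsOpen (MTop.openStar G v ε) :=
  TopologicalSpace.isOpen_generateFrom_of_mem (Or.inl (Or.inr ⟨v, ε, h0, h1, rfl⟩))

theorem MTop.isOpen_endNhd (S : Finset V) (ω : VertexEnd G) {ε : ℝ} (h0 : 0 < ε) :
    IsOpen (MTop.endNhd S ω ε) :=
  TopologicalSpace.isOpen_generateFrom_of_mem (Or.inr ⟨S, ω, ε, h0, rfl⟩)

/-- A point with a positive coordinate in `C(S, ω)` either lies in the component or is inside an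
edge from it to `S`. This turns membership into conditions on coordinates, which can be tested in
the completion. -/
theorem MTop.point_mem_endNhd {S : Finset V} {ω : VertexEnd G} {ε : ℝ} {x : Point G} :
    MTop.point x ∈ MTop.endNhd S ω ε ↔ ∃ c ∈ endComponent S ω, 0 < x.coord c ∧
      ∀ s ∈ S, 0 < x.coord s → 1 - ε < x.coord c := by
  constructor
  · rintro ((⟨y, hy, h⟩ | ⟨ω', hy, -⟩) | ⟨y, hy, s, hs, c, hc, h, hε⟩)
    · cases hy
      obtain ⟨c, -, hc⟩ := Point.exists_of_mass_pos (A := Set.univ) (x := x)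
        (by rw [Point.mass_univ]; exact one_pos)
      exact ⟨c, h c hc.ne', hc, fun s hs hxs =>
        absurd hs (notMem_of_mem_endComponent (h s hxs.ne'))⟩
    · cases hy
    · cases hy
      exact ⟨c, hc, h.2.2, fun _ _ _ => by linarith⟩
  · rintro ⟨c, hc, hxc, h⟩
    by_cases hall : ∀ v, x.coord v ≠ 0 → v ∈ endComponent S ω
    · exact Or.inl (Or.inl ⟨x, rfl, hall⟩)
    · push Not at hall
      obtain ⟨v, hv, hvC⟩ := hall
      have hv0 : 0 < x.coord v := lt_of_le_of_ne (x.coord_nonneg v) hv.symm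
      have hin : x.InnerOf v c := Point.innerOf_of_pos (by rintro rfl; exact hvC hc) hv0 hxc
      have hvS : v ∈ S := by
        by_contra hvS
        exact hvC (mem_endComponent_of_linked hc
          (Linked.of_adj (notMem_of_mem_endComponent hc) hvS hin.1.1.symm))
      exact Or.inr ⟨x, rfl, v, hvS, c, hc, hin, by linarith [h v hvS hv0]⟩

theorem MTop.vertexEnd_mem_endNhd {S : Finset V} {ω ω' : VertexEnd G} {ε : ℝ} :
    MTop.vertexEnd ω' ∈ MTop.endNhd S ω ε ↔ ω'.HasRayIn (endComponent S ω) := by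
  constructor
  · rintro ((⟨y, hy, -⟩ | ⟨ω', hy, h⟩) | ⟨y, hy, -⟩)
    · cases hy
    · cases hy; exact h
    · cases hy
  · exact fun h => Or.inl (Or.inr ⟨ω', rfl, h⟩)

namespace LTop

variable (ℓ : G.edgeSet → ℝ)

theorem dist_le (hG : G.Connected) {x y : Point G} {r : ℝ} (hr : 0 ≤ r) (h : arcDist ℓ x y ≤ ENNReal.ofReal r) :
    (LTop.metricSpace ℓ hG).dist (ofPoint ℓ x) (ofPoint ℓ y) ≤ r := by
  refine (LTop.dist_ofPoint ℓ hG x y).le.trans ?_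
  exact ENNReal.toReal_le_of_le_ofReal hr h

theorem le_dist (hG : G.Connected) {x y : Point G} {r : ℝ} (h : ENNReal.ofReal r ≤ arcDist ℓ x y) :
    r ≤ (LTop.metricSpace ℓ hG).dist (ofPoint ℓ x) (ofPoint ℓ y) := by
  refine le_trans ?_ (LTop.dist_ofPoint ℓ hG x y).ge
  exact (ENNReal.ofReal_le_iff_le_toReal (arcDist_ne_top ℓ hG x y)).1 h

theorem exists_seq_tendsto (hG : G.Connected) (z : LTop ℓ) :
    ∃ x : ℕ → Point G, Tendsto (fun k => ofPoint ℓ (x k)) atTop (𝓝 z) := by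
  let _ := LTop.metricSpace ℓ hG
  obtain ⟨y, hy, hlim⟩ := mem_closure_iff_seq_limit.1 (LTop.denseRange_ofPoint ℓ z)
  choose x hx using hy
  exact ⟨x, by simpa only [hx] using hlim⟩

end LTop

/-! ### The map from `MTOP(G)` to `|G|_ℓ` is an embedding -/

namespace NormalTree

variable (T : NormalTree G)

theorem exists_coord_extension (hG : G.Connected) (v : V) : ∃ Φ : LTop T.len → ℝ, Continuous Φ ∧
    ∀ x, Φ (LTop.ofPoint T.len x) = x.coord v :=
  LTop.exists_extension T.len hG (half_pos (T.ht_pos v)) (T.coord_lipschitz v)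

theorem exists_mass_extension (hG : G.Connected) (t : V) : ∃ Φ : LTop T.len → ℝ, Continuous Φ ∧
    ∀ x, Φ (LTop.ofPoint T.len x) = Point.mass (T.up t) x :=
  LTop.exists_extension T.len hG (T.ht_pos t) (T.mass_up_lipschitz t)

theorem ht_branch (ω : VertexEnd G) (n : ℕ) : T.ht (T.branch ω n) = (1 / 2) ^ n := by
  rw [ht, lev_branch]

/-- The vertices of the branch of an end converge in `|G|_ℓ`. -/
theorem exists_tendsto_branch (hG : G.Connected) (ω : VertexEnd G) : ∃ z : LTop T.len,
    Tendsto (fun n => LTop.ofPoint T.len (.vertex G (T.branch ω n))) atTop (𝓝 z) := by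
  let _ := LTop.metricSpace T.len hG
  refine cauchySeq_tendsto_of_complete (cauchySeq_of_le_geometric (1 / 2) 1 (by norm_num) ?_)
  intro n
  rw [dist_comm, one_mul, ← T.ht_branch ω n]
  exact LTop.dist_le T.len hG (T.ht_pos _).le (T.arcDist_up_le (T.branch_le ω (Nat.le_succ n)))

section Limits

variable {e : VertexEnd G → LTop T.len}

theorem dist_branch_le (hG : G.Connected)
    (he : ∀ ω, Tendsto (fun n => LTop.ofPoint T.len (.vertex G (T.branch ω n))) atTop (𝓝 (e ω)))
    {ω : VertexEnd G} {t : V} (h : T.branch ω (T.lev t) = t) :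
    (LTop.metricSpace T.len hG).dist (e ω) (LTop.ofPoint T.len (.vertex G t)) ≤ T.ht t := by
  let _ := LTop.metricSpace T.len hG
  refine le_of_tendsto ((he ω).dist tendsto_const_nhds) ?_
  filter_upwards [eventually_ge_atTop (T.lev t)] with n hn
  refine LTop.dist_le T.len hG (T.ht_pos t).le (T.arcDist_up_le ?_)
  have := T.branch_le ω hn
  rwa [h] at this

theorem coord_extension_end
    (he : ∀ ω, Tendsto (fun n => LTop.ofPoint T.len (.vertex G (T.branch ω n))) atTop (𝓝 (e ω)))
    {v : V} {Φ : LTop T.len → ℝ} (hΦ : Continuous Φ)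
    (h : ∀ x, Φ (LTop.ofPoint T.len x) = x.coord v) (ω : VertexEnd G) : Φ (e ω) = 0 := by
  refine tendsto_nhds_unique ((hΦ.tendsto _).comp (he ω)) (tendsto_const_nhds.congr' ?_)
  filter_upwards [eventually_gt_atTop (T.lev v)] with n hn
  rw [Function.comp_apply, h, Point.vertex_coord_ne]
  rintro rfl
  rw [T.lev_branch] at hn
  exact hn.false

/-- From level `lev t` on, the vertices of the branch are either all above `t` or all not above `t`,
so the mass is constant along this part of the branch and the limit inherits its value. -/
theorem mass_extension_end
    (he : ∀ ω, Tendsto (fun n => LTop.ofPoint T.len (.vertex G (T.branch ω n))) atTop (𝓝 (e ω)))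
    {t : V} {Φ : LTop T.len → ℝ} (hΦ : Continuous Φ)
    (h : ∀ x, Φ (LTop.ofPoint T.len x) = Point.mass (T.up t) x) (ω : VertexEnd G) :
    (T.branch ω (T.lev t) = t ∧ Φ (e ω) = 1) ∨ (T.branch ω (T.lev t) ≠ t ∧ Φ (e ω) = 0) := by
  have key : ∀ c : ℝ, (∀ n, T.lev t ≤ n → (T.up t).indicator 1 (T.branch ω n) = c) →
      Φ (e ω) = c := by
    intro c hc
    refine tendsto_nhds_unique ((hΦ.tendsto _).comp (he ω)) (tendsto_const_nhds.congr' ?_)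
    filter_upwards [eventually_ge_atTop (T.lev t)] with n hn
    rw [Function.comp_apply, h, Point.mass_vertex, hc n hn]
  by_cases hb : T.branch ω (T.lev t) = t
  · refine Or.inl ⟨hb, key 1 fun n hn => ?_⟩
    have := T.branch_le ω hn
    rw [hb] at this
    exact Set.indicator_of_mem (show _ ∈ T.up t from this) _
  · refine Or.inr ⟨hb, key 0 fun n hn => Set.indicator_of_notMem (fun hmem => hb ?_) _⟩
    exact T.eq_of_lev_eq (T.branch_le ω hn) hmem (T.lev_branch _ _)

theorem continuous_elim (hG : G.Connected)
    (he : ∀ ω, Tendsto (fun n => LTop.ofPoint T.len (.vertex G (T.branch ω n))) atTop (𝓝 (e ω))) :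
    Continuous (MTop.elim (LTop.ofPoint T.len) e) := by
  let _ := LTop.metricSpace T.len hG
  rw [continuous_iff_continuousAt]
  intro p
  rw [ContinuousAt, Metric.tendsto_nhds]
  intro ε hε
  rcases p with x | ω
  · rcases x.eq_vertex_or_innerOf with ⟨v, rfl⟩ | ⟨a, b, hab⟩
    · have hδ : 0 < min ε (1 / 2) := by positivity
      filter_upwards [(MTop.isOpen_openStar v hδ ((min_le_right _ _).trans_lt (by norm_num))).mem_nhds
        ⟨.vertex G v, rfl, by rw [Point.vertex_coord_self, sub_self]; exact hδ⟩]
      rintro _ ⟨y, rfl, hy⟩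
      have h1 := min_le_left ε (1 / 2)
      have h2 := min_le_right ε (1 / 2)
      refine (LTop.dist_le T.len hG (sub_nonneg.2 (y.coord_le_one v))
        (arcDist_vertex_le_of_pos _ T.len_le_one (by linarith))).trans_lt (by linarith)
    · filter_upwards [(MTop.isOpen_edgePart a b (Metric.isOpen_ball (x := x.coord a) (ε := ε))).mem_nhds
        ⟨x, rfl, hab, Metric.mem_ball_self hε⟩]
      rintro _ ⟨y, rfl, hy, hd⟩
      rw [Metric.mem_ball, Real.dist_eq] at hd
      refine (LTop.dist_le T.len hG (by positivity)
        (arcDist_onEdge_le T.len hy.1 hab.1 (T.len_le_one _))).trans_lt ?_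
      rwa [mul_one]
  -- The error below is at most the missing mass, less than `ε / 2`, plus three times the height of
  -- `t`; hence `ε / 6`.
  · obtain ⟨n, hn⟩ := exists_pow_lt_of_lt_one (show 0 < ε / 6 by positivity)
      (show (1 / 2 : ℝ) < 1 by norm_num)
    rw [← T.ht_branch ω n] at hn
    have hlev : T.branch ω (T.lev (T.branch ω n)) = T.branch ω n := by rw [T.lev_branch]
    have hω := T.dist_branch_le hG he hlev
    have hC := T.endComponent_branch ω n
    generalize T.branch ω n = t at *
    have ht := T.ht_pos t
    have hδ : 0 < min (ε / 2) 1 := by positivity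
    filter_upwards [(MTop.isOpen_endNhd (T.below t) ω hδ).mem_nhds
      (MTop.vertexEnd_mem_endNhd.2 (by rw [hC]; exact T.hasRayIn_of_branch_eq hlev))]
    rintro (y | ω') hy
    · rw [MTop.point_mem_endNhd, hC] at hy
      obtain ⟨c, hc, hyc, hy⟩ := hy
      have hm : 0 < Point.mass (T.up t) y := hyc.trans_le (Point.coord_le_mass hc y)
      -- On an edge to `T.below t` the coordinate at `c` is already large; otherwise the point lies
      -- entirely in the up-set and has mass 1.
      have hm' : 1 - ε / 2 < Point.mass (T.up t) y := by
        by_cases hs : ∃ s ∈ T.below t, 0 < y.coord s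
        · obtain ⟨s, hs, hys⟩ := hs
          have := hy s hs hys
          have := Point.coord_le_mass hc y
          have := min_le_left (ε / 2) 1
          linarith
        · push Not at hs
          have : Point.mass (T.up t) y = 1 := Point.mass_eq_one fun w hw => by
            have hw0 : 0 < y.coord w := lt_of_le_of_ne (y.coord_nonneg w) hw.symm
            by_cases hwc : w = c
            · rwa [hwc]
            · refine T.mem_up_of_linked hc (Linked.of_adj (T.up_subset_compl_below t hc)
                (fun h => ?_) (Point.innerOf_of_pos hwc hw0 hyc).1.1.symm)
              exact hw0.not_ge (hs w h)
          linarith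
      have h1 := LTop.dist_le T.len hG
        (by linarith [Point.mass_le_one (T.up t) y]) (T.arcDist_mass_le hm)
      calc dist (LTop.ofPoint T.len y) (e ω)
          ≤ dist (LTop.ofPoint T.len y) (LTop.ofPoint T.len (.vertex G t)) +
            dist (e ω) (LTop.ofPoint T.len (.vertex G t)) := dist_triangle_right _ _ _
        _ ≤ (1 - Point.mass (T.up t) y + 2 * T.ht t) + T.ht t := add_le_add h1 hω
        _ < ε := by linarith
    · rw [MTop.vertexEnd_mem_endNhd, hC] at hy
      have h1 := T.dist_branch_le hG he (T.branch_eq_of_hasRayIn hy)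
      calc dist (e ω') (e ω)
          ≤ dist (e ω') (LTop.ofPoint T.len (.vertex G t)) +
            dist (e ω) (LTop.ofPoint T.len (.vertex G t)) := dist_triangle_right _ _ _
        _ ≤ T.ht t + T.ht t := add_le_add h1 hω
        _ < ε := by linarith

/-- The extended coordinates separate points of `G` from each other, and from the ends, where they
all vanish. The extended masses of up-sets recover the branch of an end, which determines the end.
-/
theorem injective_elim (hG : G.Connected)
    (he : ∀ ω, Tendsto (fun n => LTop.ofPoint T.len (.vertex G (T.branch ω n))) atTop (𝓝 (e ω))) :
    Function.Injective (MTop.elim (LTop.ofPoint T.len) e) := by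
  choose Φ hΦ hΦx using T.exists_coord_extension hG
  choose Ψ hΨ hΨx using T.exists_mass_extension hG
  have hne : ∀ x ω, LTop.ofPoint T.len x ≠ e ω := by
    intro x ω h
    obtain ⟨c, -, hc⟩ := Point.exists_of_mass_pos (A := Set.univ) (x := x)
        (by rw [Point.mass_univ]; exact one_pos)
    rw [← hΦx, h, T.coord_extension_end he (hΦ c) (hΦx c)] at hc
    exact hc.false
  rintro (x | ω) (y | ω') h
  · refine congrArg _ (Point.ext_coord fun w => ?_)
    rw [← hΦx, ← hΦx]
    exact congrArg (Φ w) h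
  · exact absurd h (hne x ω')
  · exact absurd h.symm (hne y ω)
  · refine congrArg _ (T.branch_injective (funext fun n => ?_))
    have hω := T.mass_extension_end he (hΨ _) (hΨx (T.branch ω n)) ω
    have hω' := T.mass_extension_end he (hΨ _) (hΨx (T.branch ω n)) ω'
    rw [T.lev_branch, show e ω = e ω' from h] at hω
    rw [T.lev_branch] at hω'
    rcases hω with hω | hω
    · rcases hω' with hω' | hω'
      · exact hω'.1.symm
      · linarith [hω.2, hω'.2]
    · exact absurd rfl hω.1

/-- The generating sets of `MTOP(G)` are open in the topology induced from `|G|_ℓ`. -/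
theorem isInducing_elim (hG : G.Connected)
    (he : ∀ ω, Tendsto (fun n => LTop.ofPoint T.len (.vertex G (T.branch ω n))) atTop (𝓝 (e ω))) :
    IsInducing (MTop.elim (LTop.ofPoint T.len) e) := by
  choose Φ hΦ hΦx using T.exists_coord_extension hG
  choose Ψ hΨ hΨx using T.exists_mass_extension hG
  have hΦe := fun v => T.coord_extension_end he (hΦ v) (hΦx v)
  have hΨe := fun t => T.mass_extension_end he (hΨ t) (hΨx t)
  have hlt : ∀ {F : LTop T.len → ℝ}, Continuous F → ∀ c, IsOpen {z | c < F z} :=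
    fun hF c => isOpen_lt continuous_const hF
  refine ⟨le_antisymm (T.continuous_elim hG he).le_induced (le_generateFrom fun A hA => ?_)⟩
  suffices hs : ∀ p ∈ A, ∃ W : Set (LTop T.len), IsOpen W ∧
      MTop.elim (LTop.ofPoint T.len) e p ∈ W ∧ ∀ q, MTop.elim (LTop.ofPoint T.len) e q ∈ W → q ∈ A by
    refine (@isOpen_iff_forall_mem_open _ (TopologicalSpace.induced _ _) A).2 fun p hp => ?_
    obtain ⟨W, hW, hpW, hWA⟩ := hs p hp
    exact ⟨_, hWA, isOpen_induced hW, hpW⟩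
  rcases hA with (⟨a, b, U, hU, rfl⟩ | ⟨v, ε, h0, h1, rfl⟩) | ⟨S, ω, ε, h0, rfl⟩
  · rintro _ ⟨x, rfl, hx, hxU⟩
    refine ⟨Φ a ⁻¹' U ∩ ({z | 0 < Φ a z} ∩ {z | 0 < Φ b z}),
      (hU.preimage (hΦ a)).inter ((hlt (hΦ a) 0).inter (hlt (hΦ b) 0)), ?_, ?_⟩
    · change Φ a (LTop.ofPoint _ x) ∈ U ∧ 0 < Φ a (LTop.ofPoint _ x) ∧ 0 < Φ b (LTop.ofPoint _ x)
      rw [hΦx, hΦx]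
      exact ⟨hxU, hx.2.1, hx.2.2⟩
    · rintro (y | ω) hq
      · replace hq : Φ a (LTop.ofPoint _ y) ∈ U ∧ 0 < Φ a (LTop.ofPoint _ y) ∧
          0 < Φ b (LTop.ofPoint _ y) := hq
        rw [hΦx, hΦx] at hq
        exact ⟨y, rfl, Point.innerOf_of_pos hx.1.1.ne hq.2.1 hq.2.2, hq.1⟩
      · exact absurd (hΦe a ω) (ne_of_gt hq.2.1)
  · rintro _ ⟨x, rfl, hx⟩
    refine ⟨{z | 1 - ε < Φ v z}, hlt (hΦ v) _, ?_, ?_⟩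
    · change 1 - ε < Φ v (LTop.ofPoint _ x)
      rw [hΦx]
      linarith
    · rintro (y | ω) hq
      · replace hq : 1 - ε < Φ v (LTop.ofPoint _ y) := hq
        rw [hΦx] at hq
        exact ⟨y, rfl, by linarith⟩
      · replace hq : 1 - ε < Φ v (e ω) := hq
        rw [hΦe] at hq
        linarith
  · rintro (x | ω') hp
    · obtain ⟨c, hc, hxc, h⟩ := MTop.point_mem_endNhd.1 hp
      -- If so, a lower bound on the coordinate at `c` already forces membership. If not, `x` is
      -- inside an edge with no end in `S`, and the whole open edge is a neighbourhood. The maximum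
      -- with 0 is needed since `ε` may exceed 1.
      by_cases hall : 1 - ε < x.coord c
      · refine ⟨{z | max 0 (1 - ε) < Φ c z}, hlt (hΦ c) _, ?_, ?_⟩
        · change max 0 (1 - ε) < Φ c (LTop.ofPoint _ x)
          rw [hΦx]
          exact max_lt hxc hall
        · rintro (y | ω'') hq
          · replace hq : max 0 (1 - ε) < Φ c (LTop.ofPoint _ y) := hq
            rw [hΦx, max_lt_iff] at hq
            exact MTop.point_mem_endNhd.2 ⟨c, hc, hq.1, fun _ _ _ => hq.2⟩
          · replace hq : max 0 (1 - ε) < Φ c (e ω'') := hq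
            rw [hΦe, max_lt_iff] at hq
            exact absurd hq.1 (lt_irrefl _)
      · rcases x.eq_vertex_or_innerOf with ⟨d, rfl⟩ | ⟨a, b, hab⟩
        · have : c = d := by
            by_contra hne
            rw [Point.vertex_coord_ne hne] at hxc
            exact hxc.false
          rw [this, Point.vertex_coord_self] at hall
          exact absurd (by linarith) hall
        have hS : ∀ w, 0 < x.coord w → w ∉ S := fun w hw hwS => hall (h w hwS hw)
        refine ⟨{z | 0 < Φ a z} ∩ {z | 0 < Φ b z}, (hlt (hΦ a) 0).inter (hlt (hΦ b) 0), ?_, ?_⟩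
        · change 0 < Φ a (LTop.ofPoint _ x) ∧ 0 < Φ b (LTop.ofPoint _ x)
          rw [hΦx, hΦx]
          exact hab.2
        · rintro (y | ω'') hq
          · replace hq : 0 < Φ a (LTop.ofPoint _ y) ∧ 0 < Φ b (LTop.ofPoint _ y) := hq
            rw [hΦx, hΦx] at hq
            have hy := Point.innerOf_of_pos hab.1.1.ne hq.1 hq.2
            refine MTop.point_mem_endNhd.2 ⟨c, hc, ?_, fun s hs hys => ?_⟩
            · by_contra hyc
              by_cases hca : c = a
              · exact hyc (hca ▸ hq.1)
              by_cases hcb : c = b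
              · exact hyc (hcb ▸ hq.2)
              exact hxc.ne' (hab.1.coord_eq_zero hca hcb)
            · by_cases hsa : s = a
              · exact absurd hs (hsa ▸ hS a hab.2.1)
              by_cases hsb : s = b
              · exact absurd hs (hsb ▸ hS b hab.2.2)
              exact absurd (hy.1.coord_eq_zero hsa hsb) hys.ne'
          · exact absurd (hΦe a ω'') (ne_of_gt hq.1)
    · have hω := endComponent_eq_of_hasRayIn (MTop.vertexEnd_mem_endNhd.1 hp)
      obtain ⟨n, hn⟩ := T.exists_disjoint_branch S ω'
      have hsub := T.up_branch_subset hn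
      rw [hω] at hsub
      have hlev : T.branch ω' (T.lev (T.branch ω' n)) = T.branch ω' n := by rw [T.lev_branch]
      generalize T.branch ω' n = t at *
      -- The up-set of `t` misses `S` and lies in the component. A point with positive mass in it
      -- has a positive coordinate there, and if its other end is in `S`, that coordinate is the
      -- whole mass.
      refine ⟨{z | max 0 (1 - ε) < Ψ t z}, hlt (hΨ t) _, ?_, ?_⟩
      · change max 0 (1 - ε) < Ψ t (e ω')
        rcases hΨe t ω' with h | h
        · rw [h.2]
          exact max_lt one_pos (by linarith)
        · exact absurd hlev h.1
      · rintro (y | ω'') hq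
        · replace hq : max 0 (1 - ε) < Ψ t (LTop.ofPoint _ y) := hq
          rw [hΨx, max_lt_iff] at hq
          obtain ⟨c, hc, hyc⟩ := Point.exists_of_mass_pos hq.1
          refine MTop.point_mem_endNhd.2 ⟨c, hsub hc, hyc, fun s hs hys => ?_⟩
          have hst : s ∉ T.up t := fun h => hn h hs
          have hcs : c ≠ s := by
            rintro rfl
            exact hst hc
          have := Point.mass_of_onEdge (T.up t) (Point.innerOf_of_pos hcs hyc hys).1
          rw [Set.indicator_of_mem hc, Set.indicator_of_notMem hst] at this
          linarith
        · replace hq : max 0 (1 - ε) < Ψ t (e ω'') := hq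
          rcases hΨe t ω'' with h | h
          · exact MTop.vertexEnd_mem_endNhd.2 ((T.hasRayIn_of_branch_eq h.1).mono hsub)
          · rw [h.2] at hq
            exact absurd ((le_max_left _ _).trans_lt hq) (lt_irrefl _)

end Limits

end NormalTree

/-! ### The completion adds only the limits of branches -/

namespace NormalTree

variable (T : NormalTree G)

/-- A point of `|G|_ℓ` with a positive coordinate is a point of `G`. -/
theorem exists_ofPoint_eq (hG : G.Connected) {v : V} {Φ : LTop T.len → ℝ} (hΦ : Continuous Φ)
    (hΦx : ∀ x, Φ (LTop.ofPoint T.len x) = x.coord v) {z : LTop T.len} (hz : 0 < Φ z) :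
    ∃ x, LTop.ofPoint T.len x = z := by
  let _ := LTop.metricSpace T.len hG
  obtain ⟨x, hx⟩ := LTop.exists_seq_tendsto T.len hG z
  have hcoord : Tendsto (fun k => (x k).coord v) atTop (𝓝 (Φ z)) := by
    simpa only [Function.comp_def, hΦx] using (hΦ.tendsto z).comp hx
  have hle : Φ z ≤ 1 := le_of_tendsto' hcoord fun k => (x k).coord_le_one v
  -- A limit coordinate of 1 forces convergence to `v`. Otherwise the sequence finally stays in one
  -- edge at `v`, away from its ends, and converges to the point of that edge with coordinate `Φ z`.
  rcases hle.eq_or_lt with h1 | h1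
  · refine ⟨.vertex G v, tendsto_nhds_unique (tendsto_iff_dist_tendsto_zero.2 ?_) hx⟩
    have hlim : Tendsto (fun k => 1 - (x k).coord v) atTop (𝓝 0) := by
      simpa [h1] using hcoord.const_sub 1
    refine squeeze_zero' (Eventually.of_forall fun _ => dist_nonneg) ?_ hlim
    filter_upwards [hcoord.eventually (lt_mem_nhds hz)] with k hk
    exact LTop.dist_le T.len hG (sub_nonneg.2 ((x k).coord_le_one v))
      (arcDist_vertex_le_of_pos _ T.len_le_one hk)
  · obtain ⟨η, hη0, hη1, hη2⟩ : ∃ η : ℝ, 0 < η ∧ η < Φ z ∧ Φ z < 1 - η := by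
      refine ⟨min (Φ z) (1 - Φ z) / 2, ?_, ?_, ?_⟩
      · have : 0 < min (Φ z) (1 - Φ z) := lt_min hz (by linarith)
        linarith
      · linarith [min_le_left (Φ z) (1 - Φ z)]
      · linarith [min_le_right (Φ z) (1 - Φ z)]
    have ht := T.ht_pos v
    obtain ⟨K, hK⟩ := eventually_atTop.1 ((hcoord.eventually (lt_mem_nhds hη1)).and
      (hcoord.eventually (gt_mem_nhds hη2)))
    -- Two such distances add up to `T.ht v / 2 * η`. The smaller of the two coordinates on the edge
    -- exceeds `η` at stage `M` and changes by less than `η` afterwards, so it remains positive.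
    obtain ⟨K', hK'⟩ := Metric.cauchySeq_iff'.1 hx.cauchySeq (T.ht v / 2 * (η / 2)) (by positivity)
    obtain ⟨M, hMK, hM⟩ : ∃ M, K ≤ M ∧ ∀ k, M ≤ k → dist (LTop.ofPoint T.len (x k))
        (LTop.ofPoint T.len (x M)) < T.ht v / 2 * η := by
      refine ⟨max K K', le_max_left _ _, fun k hk => ?_⟩
      have h1 := hK' k ((le_max_right _ _).trans hk)
      have h2 := hK' (max K K') (le_max_right _ _)
      have := dist_triangle_right (LTop.ofPoint T.len (x k)) (LTop.ofPoint T.len (x (max K K')))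
        (LTop.ofPoint T.len (x K'))
      linarith
    obtain ⟨hM1, hM2⟩ := hK M hMK
    obtain ⟨w, hw⟩ : ∃ w, (x M).InnerOf v w := by
      rcases (x M).eq_vertex_or_innerOf with ⟨c, hc⟩ | ⟨c, d, hcd⟩
      · rw [hc] at hM1 hM2
        by_cases h : v = c
        · rw [h, Point.vertex_coord_self] at hM2; linarith
        · rw [Point.vertex_coord_ne h] at hM1; linarith
      · by_cases h : v = c
        · exact ⟨d, h ▸ hcd⟩
        by_cases h' : v = d
        · exact ⟨c, h' ▸ hcd.symm⟩
        rw [hcd.1.coord_eq_zero h h'] at hM1; linarith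
    have hin : ∀ k, M ≤ k → (x k).InnerOf v w := by
      intro k hk
      have h1 := LTop.le_dist T.len hG (min_coord_lipschitz T.len hw.1.1 (half_pos ht).le T.len_pos
        (T.half_ht_le_len hw.1.1) (x k) (x M))
      have h2 := lt_of_mul_lt_mul_left (h1.trans_lt (hM k hk)) (half_pos ht).le
      have h3 : η < min ((x M).coord v) ((x M).coord w) :=
        lt_min hM1 (by linarith [hw.1.2])
      have h4 : 0 < min ((x k).coord v) ((x k).coord w) := by
        linarith [(abs_lt.1 h2).1]
      exact Point.innerOf_of_pos hw.1.1.ne (lt_min_iff.1 h4).1 (lt_min_iff.1 h4).2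
    obtain ⟨y, hy, hyv⟩ := Point.exists_innerOf hw.1.1 hz h1
    refine ⟨y, tendsto_nhds_unique (tendsto_iff_dist_tendsto_zero.2 ?_) hx⟩
    have hlim : Tendsto (fun k => |(x k).coord v - y.coord v| * 1) atTop (𝓝 0) := by
      simpa [hyv] using (hcoord.sub_const (Φ z)).abs
    refine squeeze_zero' (Eventually.of_forall fun _ => dist_nonneg) ?_ hlim
    filter_upwards [eventually_ge_atTop M] with k hk
    exact LTop.dist_le T.len hG (by positivity)
      (arcDist_onEdge_le T.len (hin k hk).1 hy.1 (T.len_le_one _))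

/-- A point of `|G|_ℓ` all of whose coordinates vanish lies in the closure of one of the up-sets of
each level. -/
theorem exists_mass_eq_one (hG : G.Connected) {Φ Ψ : V → LTop T.len → ℝ}
    (hΦ : ∀ v, Continuous (Φ v)) (hΦx : ∀ v x, Φ v (LTop.ofPoint T.len x) = x.coord v)
    (hΨ : ∀ v, Continuous (Ψ v)) (hΨx : ∀ v x, Ψ v (LTop.ofPoint T.len x) = Point.mass (T.up v) x)
    {z : LTop T.len} (hz : ∀ v, Φ v z ≤ 0) (n : ℕ) : ∃ t, T.lev t = n ∧ Ψ t z = 1 := by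
  let _ := LTop.metricSpace T.len hG
  obtain ⟨x, hx⟩ := LTop.exists_seq_tendsto T.len hG z
  have hcoord : ∀ v, Tendsto (fun k => (x k).coord v) atTop (𝓝 (Φ v z)) := fun v => by
    simpa only [Function.comp_def, hΦx] using ((hΦ v).tendsto z).comp hx
  have hmass : ∀ v, Tendsto (fun k => Point.mass (T.up v) (x k)) atTop (𝓝 (Ψ v z)) := fun v => by
    simpa only [Function.comp_def, hΨx] using ((hΨ v).tendsto z).comp hx
  induction n with
  | zero =>
    refine ⟨T.root, T.lev_root, tendsto_nhds_unique (hmass T.root) ?_⟩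
    exact tendsto_const_nhds.congr fun k => (Point.mass_eq_one fun w _ => T.root_le w).symm
  | succ n ih =>
    obtain ⟨t, rfl, ht1⟩ := ih
    have ht := T.ht_pos t
    -- In the limit all mass is above `t` and none at `t`. Late terms have mass over 3/4 above `t`
    -- and less than 1/4 at `t`, so some child carries more than 1/2.
    obtain ⟨K, hK⟩ := eventually_atTop.1
      (((hmass t).eventually (lt_mem_nhds (show (3 / 4 : ℝ) < Ψ t z by rw [ht1]; norm_num))).and
      ((hcoord t).eventually (gt_mem_nhds (show Φ t z < 1 / 4 by linarith [hz t]))))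
    -- A child has half the height of `t`, so after stage `M` the mass above the child `c` changes
    -- by less than 1/4 and stays positive. Distinct children cannot both carry mass of one point,
    -- so `c` is the child for all later terms.
    obtain ⟨K', hK'⟩ := Metric.cauchySeq_iff'.1 hx.cauchySeq (T.ht t / 16) (by positivity)
    obtain ⟨M, hMK, hM⟩ : ∃ M, K ≤ M ∧ ∀ k, M ≤ k → dist (LTop.ofPoint T.len (x k))
        (LTop.ofPoint T.len (x M)) < T.ht t / 2 * (1 / 4) := by
      refine ⟨max K K', le_max_left _ _, fun k hk => ?_⟩
      have h1 := hK' k ((le_max_right _ _).trans hk)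
      have h2 := hK' (max K K') (le_max_right _ _)
      have := dist_triangle_right (LTop.ofPoint T.len (x k)) (LTop.ofPoint T.len (x (max K K')))
        (LTop.ofPoint T.len (x K'))
      linarith
    have hchild : ∀ k, M ≤ k → ∃ c, T.lev c = T.lev t + 1 ∧
        Point.mass (T.up t) (x k) ≤ (x k).coord t + Point.mass (T.up c) (x k) ∧
        1 / 2 < Point.mass (T.up c) (x k) := by
      intro k hk
      obtain ⟨h1, h2⟩ := hK k (hMK.trans hk)
      obtain ⟨c, hc, hm⟩ := T.exists_child_mass (t := t) (x := x k) (by linarith)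
      exact ⟨c, hc, hm, by linarith⟩
    obtain ⟨c, hc, -, hcM⟩ := hchild M le_rfl
    have hhtc : T.ht c = T.ht t / 2 := by rw [NormalTree.ht, NormalTree.ht, hc, pow_succ]; ring
    have hkey : ∀ k, M ≤ k →
        Point.mass (T.up t) (x k) - (x k).coord t ≤ Point.mass (T.up c) (x k) := by
      intro k hk
      obtain ⟨d, hd, hm, hdk⟩ := hchild k hk
      have h1 := LTop.le_dist T.len hG (T.mass_up_lipschitz c (x k) (x M))
      rw [hhtc] at h1
      have h2 := lt_of_mul_lt_mul_left (h1.trans_lt (hM k hk)) (half_pos ht).le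
      have h3 : 0 < Point.mass (T.up c) (x k) := by linarith [(abs_lt.1 h2).1]
      obtain ⟨a, hca, hda⟩ := T.exists_le_of_mass_pos h3 (by linarith : 0 < Point.mass (T.up d) (x k))
      rw [T.eq_of_lev_eq hca hda (hc.trans hd.symm)]
      linarith
    refine ⟨c, hc, le_antisymm (le_of_tendsto' (hmass c) fun k => Point.mass_le_one _ _) ?_⟩
    have h1 : Ψ t z - Φ t z ≤ Ψ c z := by
      refine le_of_tendsto_of_tendsto ((hmass t).sub (hcoord t)) (hmass c) ?_
      filter_upwards [eventually_ge_atTop M] with k hk using hkey k hk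
    linarith [hz t]

/-- If all coordinates of `z` vanish, the vertices whose up-sets carry full mass at `z` form a
branch. By `arcDist_mass_le`, `z` is within twice the height of each of them, so the branch
converges to `z`. -/
theorem surjective_elim (hG : G.Connected) {e : VertexEnd G → LTop T.len}
    (he : ∀ ω, Tendsto (fun n => LTop.ofPoint T.len (.vertex G (T.branch ω n))) atTop (𝓝 (e ω))) :
    Function.Surjective (MTop.elim (LTop.ofPoint T.len) e) := by
  intro z
  choose Φ hΦ hΦx using T.exists_coord_extension hG
  choose Ψ hΨ hΨx using T.exists_mass_extension hG
  by_cases hz : ∃ v, 0 < Φ v z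
  · obtain ⟨v, hv⟩ := hz
    obtain ⟨x, hx⟩ := T.exists_ofPoint_eq hG (hΦ v) (hΦx v) hv
    exact ⟨.point x, hx⟩
  · push Not at hz
    choose t htl ht1 using T.exists_mass_eq_one hG hΦ hΦx hΨ hΨx hz
    let _ := LTop.metricSpace T.len hG
    obtain ⟨x, hx⟩ := LTop.exists_seq_tendsto T.len hG z
    have hmass : ∀ n, Tendsto (fun k => Point.mass (T.up (t n)) (x k)) atTop (𝓝 1) := fun n => by
      rw [← ht1 n]
      simpa only [Function.comp_def, hΨx] using ((hΨ (t n)).tendsto z).comp hx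
    have hpos : ∀ n, ∀ᶠ k in atTop, 0 < Point.mass (T.up (t n)) (x k) :=
      fun n => (hmass n).eventually (lt_mem_nhds one_pos)
    have hle : ∀ n, T.le (t n) (t (n + 1)) := by
      intro n
      obtain ⟨k, h1, h2⟩ := ((hpos n).and (hpos (n + 1))).exists
      obtain ⟨c, hc, hc'⟩ := T.exists_le_of_mass_pos h1 h2
      exact T.le_of_lev_le hc hc' (by rw [htl, htl]; omega)
    refine ⟨.vertexEnd (Quotient.mk _ (T.rayOfBranch t htl hle)), ?_⟩
    have h1 := he (Quotient.mk _ (T.rayOfBranch t htl hle))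
    simp only [T.branch_rayOfBranch] at h1
    refine tendsto_nhds_unique h1 (tendsto_iff_dist_tendsto_zero.2 ?_)
    have hlim : Tendsto (fun n : ℕ => 2 * (1 / 2 : ℝ) ^ n) atTop (𝓝 0) := by
      simpa using (tendsto_pow_atTop_nhds_zero_of_lt_one (r := (1 / 2 : ℝ)) (by norm_num)
        (by norm_num)).const_mul 2
    refine squeeze_zero (fun _ => dist_nonneg) (fun n => ?_) hlim
    have h2 : Tendsto (fun k => 1 - Point.mass (T.up (t n)) (x k) + 2 * T.ht (t n)) atTop
        (𝓝 (2 * (1 / 2 : ℝ) ^ n)) := by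
      have := ((hmass n).const_sub 1).add_const (2 * T.ht (t n))
      have hn : T.ht (t n) = (1 / 2) ^ n := by rw [ht, htl]
      rw [← hn]
      rwa [sub_self, zero_add] at this
    rw [dist_comm]
    refine le_of_tendsto_of_tendsto (hx.dist tendsto_const_nhds) h2 ?_
    filter_upwards [hpos n] with k hk
    refine LTop.dist_le T.len hG ?_ (T.arcDist_mass_le hk)
    have := T.ht_pos (t n)
    linarith [Point.mass_le_one (T.up (t n)) (x k)]

theorem homeomorphicOver (hG : G.Connected) :
    HomeomorphicOver (LTop.ofPoint T.len) (MTop.point (G := G)) := by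
  choose e he using T.exists_tendsto_branch hG
  let h : MTop G ≃ₜ LTop T.len :=
    (Equiv.ofBijective _ ⟨T.injective_elim hG he, T.surjective_elim hG he⟩).toHomeomorphOfIsInducing
      (T.isInducing_elim hG he)
  exact ⟨h.symm, fun x => h.symm_apply_apply (.point x)⟩

end NormalTree

end GraphCompletion

theorem mainTheorem8 {V : Type*} (G : SimpleGraph V) (hG : G.Connected) :
    (∃ ℓ : G.edgeSet → ℝ, (∀ e, 0 < ℓ e) ∧
      GraphCompletion.HomeomorphicOver
        (GraphCompletion.LTop.ofPoint ℓ) (GraphCompletion.MTop.point (G := G))) ↔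
    TopologicalSpace.MetrizableSpace (GraphCompletion.MTop G) := by
  constructor
  · rintro ⟨ℓ, -, h, -⟩
    have := GraphCompletion.LTop.metrizable ℓ hG
    exact h.symm.isEmbedding.metrizableSpace
  · intro _
    obtain ⟨r, hr⟩ := GraphCompletion.exists_rank (G := G)
    obtain ⟨T⟩ := GraphCompletion.exists_normalTree hG hr
    exact ⟨T.len, T.len_pos, T.homeomorphicOver hG⟩
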